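/- Let $N\ge 1$ be an integer, $m>1$ and $\sigma\in(-\infty,-2]$. Let $\mathcal{X}=H^1(\mathbb{R}^N)\cap L^{(m+1)/m}(\mathbb{R}^N)$. A non-negative function $v\in\mathcal{X}$ is called a variational solution of $$-\Delta v(x)+\frac{1}{m-1}\,v^{1/m}(x)=|x|^{\sigma}v(x),\qquad x\in\mathbb{R}^N,$$ if, for every $\varphi\in H^1(\mathbb{R}^N)$, the function $\nabla v\cdot\nabla\varphi+\frac{1}{m-1}v^{1/m}\varphi-|x|^{\sigma}v\varphi$ is integrable on $\mathbb{R}^N$ and $$\int_{\mathbb{R}^N}\Big[\nabla v(x)\cdot\nabla\varphi(x)+\frac{1}{m-1}\,v^{1/m}(x)\varphi(x)-|x|^{\sigma}v(x)\varphi(x)\Big]\,dx=0.$$ Then there is no non-negative variational solution $v\in\mathcal{X}$ of this equation other than $v=0$ (almost everywhere). -/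

import Mathlib

open MeasureTheory

/-- `G` is the weak (distributional) gradient of `u` on `ℝ^N`: both are locally integrable and
`∫ u ∂ᵢη = - ∫ Gᵢ η` for every coordinate `i` and every test function `η ∈ C_c^∞(ℝ^N)`. -/
def HasWeakGradient {N : ℕ} (u : EuclideanSpace ℝ (Fin N) → ℝ)
    (G : EuclideanSpace ℝ (Fin N) → EuclideanSpace ℝ (Fin N)) : Prop :=
  LocallyIntegrable u volume ∧ LocallyIntegrable G volume ∧
    ∀ η : EuclideanSpace ℝ (Fin N) → ℝ, ContDiff ℝ (⊤ : ℕ∞) η → HasCompactSupport η →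
      ∀ i : Fin N,
        ∫ x, u x * fderiv ℝ η x (EuclideanSpace.single i 1) = - ∫ x, G x i * η x

/-- `u ∈ H^1(ℝ^N)`, with weak gradient `G`. -/
def MemH1With {N : ℕ} (u : EuclideanSpace ℝ (Fin N) → ℝ)
    (G : EuclideanSpace ℝ (Fin N) → EuclideanSpace ℝ (Fin N)) : Prop :=
  MemLp u 2 volume ∧ MemLp G 2 volume ∧ HasWeakGradient u G

/-- `u ∈ H^1(ℝ^N)`: `u` is square integrable and has a square integrable weak gradient. -/
def MemH1 {N : ℕ} (u : EuclideanSpace ℝ (Fin N) → ℝ) : Prop :=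
  ∃ G : EuclideanSpace ℝ (Fin N) → EuclideanSpace ℝ (Fin N), MemH1With u G

/-- `u ∈ X = H^1(ℝ^N) ∩ L^{(m+1)/m}(ℝ^N)`. -/
def MemX {N : ℕ} (m : ℝ) (u : EuclideanSpace ℝ (Fin N) → ℝ) : Prop :=
  MemH1 u ∧ MemLp u (ENNReal.ofReal ((m + 1) / m)) volume

/-- The integrand `∇v · ∇φ + v^{1/m} φ / (m - 1) - |x|^σ v φ` of the weak formulation, where
`Dv` and `Dφ` are the weak gradients of `v` and `φ`. -/
noncomputable def weakIntegrand {N : ℕ} (m σ : ℝ) (v φ : EuclideanSpace ℝ (Fin N) → ℝ)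
    (Dv Dφ : EuclideanSpace ℝ (Fin N) → EuclideanSpace ℝ (Fin N))
    (x : EuclideanSpace ℝ (Fin N)) : ℝ :=
  inner ℝ (Dv x) (Dφ x) + 1 / (m - 1) * v x ^ (1 / m) * φ x - ‖x‖ ^ σ * v x * φ x

/-- A non-negative `v ∈ X` is a variational solution of
`-Δv + v^{1/m} / (m - 1) = |x|^σ v` on `ℝ^N` if, for every `φ ∈ H^1(ℝ^N)`, the integrand of the
weak formulation is integrable and has integral zero. (Weak gradients are unique up to null sets,
so the choice of `Dv` and `Dφ` does not matter.) -/
def IsNonnegVariationalSolution {N : ℕ} (m σ : ℝ) (v : EuclideanSpace ℝ (Fin N) → ℝ) : Prop :=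
  MemX m v ∧ (∀ᵐ x, 0 ≤ v x) ∧
    ∃ Dv : EuclideanSpace ℝ (Fin N) → EuclideanSpace ℝ (Fin N), MemH1With v Dv ∧
      ∀ φ : EuclideanSpace ℝ (Fin N) → ℝ,
      ∀ Dφ : EuclideanSpace ℝ (Fin N) → EuclideanSpace ℝ (Fin N), MemH1With φ Dφ →
        Integrable (weakIntegrand m σ v φ Dv Dφ) volume ∧
          ∫ x, weakIntegrand m σ v φ Dv Dφ x = 0

/-! The obstruction is a Pohozaev inequality. Formally the equation is tested with the generator of
dilations, x·∇v + (N/2 - 1)v, but this need not lie in H^1 when v does. The generator is therefore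
replaced by a symmetric difference: the equation is tested with `cutoff R` times v(r·) and `cutoff
R` times v(r⁻¹·), the two identities are weighted by r^θ and r^(-θ) with θ = N/2 - 1 and subtracted,
the result is divided by r - 1, and r → 1+ is taken before R → ∞.

Apart from the cutoff, the gradient terms cancel exactly by scaling
(`abs_integral_cutoff_inner_dilation_le`). The potential terms have a favourable sign because σ ≤ -2
(`integral_cutoff_potential_dilation_nonneg`), so the singular weight never has to be estimated. The
absorption terms are treated by Young's inequality from above and by a reverse Young inequality from
below (`integral_cutoff_absorption_dilation_le`). With p = (m+1)/m and q = 1/p they leave (2qN - N +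
2)∫v^p, whose coefficient is at least 2 since q ≥ 1/2.

The reverse inequality costs |v - v(r⁻¹·)|^p. Its truncated integral is o(r - 1), since p > 1 and
v(r·) - v is O(r - 1) in L² on balls (`exists_integral_sub_dilation_sq_le`). All cutoff errors are
bounded by tails of |∇v|² and v^p or by a multiple of 1/R (`truncated_pohozaev`). Hence ∫v^p ≤ 0. -/

/-! ### Dilations in Lebesgue spaces; Cauchy–Schwarz. -/

section Lebesgue

variable {E F : Type*} [NormedAddCommGroup E] [NormedSpace ℝ E] [MeasurableSpace E] [BorelSpace E]
  [FiniteDimensional ℝ E] [NormedAddCommGroup F]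

theorem memLp_comp_smul {μ : Measure E} [μ.IsAddHaarMeasure] {f : E → F} {p : ENNReal}
    (hf : MemLp f p μ) {r : ℝ} (hr : r ≠ 0) : MemLp (fun x => f (r • x)) p μ := by
  have h : MemLp f p (Measure.map (r • ·) μ) := by
    rw [Measure.map_addHaar_smul μ hr]
    exact hf.smul_measure ENNReal.ofReal_ne_top
  exact h.comp_of_map (measurable_const_smul r).aemeasurable

end Lebesgue

section CauchySchwarz

variable {α F G : Type*} [MeasurableSpace α] {μ : Measure α} [NormedAddCommGroup F]
  [NormedAddCommGroup G]

theorem integrable_norm_mul_norm {f : α → F} {g : α → G} (hf : MemLp f 2 μ) (hg : MemLp g 2 μ) :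
    Integrable (fun x => ‖f x‖ * ‖g x‖) μ :=
  hf.norm.integrable_mul hg.norm

theorem integrable_norm_sq {f : α → F} (hf : MemLp f 2 μ) : Integrable (fun x => ‖f x‖ ^ 2) μ :=
  (memLp_two_iff_integrable_sq_norm hf.1).1 hf

theorem integral_norm_mul_norm_le {f : α → F} {g : α → G} (hf : MemLp f 2 μ) (hg : MemLp g 2 μ) :
    ∫ x, ‖f x‖ * ‖g x‖ ∂μ ≤ √(∫ x, ‖f x‖ ^ 2 ∂μ) * √(∫ x, ‖g x‖ ^ 2 ∂μ) := by
  have h := integral_mul_norm_le_Lp_mul_Lq (μ := μ) (f := fun x => ‖f x‖) (g := fun x => ‖g x‖)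
    Real.HolderConjugate.two_two (by simpa using hf.norm) (by simpa using hg.norm)
  simpa [Real.sqrt_eq_rpow] using h

theorem integrable_inner {H : Type*} [NormedAddCommGroup H] [InnerProductSpace ℝ H]
    {f g : α → H} (hf : MemLp f 2 μ) (hg : MemLp g 2 μ) :
    Integrable (fun x => inner ℝ (f x) (g x)) μ :=
  (integrable_norm_mul_norm hf hg).mono' (hf.1.inner hg.1)
    (.of_forall fun x => norm_inner_le_norm (f x) (g x))

theorem memLp_bdd_smul [NormedSpace ℝ F] {p : ENNReal} {f : α → F} (hf : MemLp f p μ) {c : α → ℝ}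
    (hc : AEStronglyMeasurable c μ) {C : ℝ} (hC : ∀ x, |c x| ≤ C) :
    MemLp (fun x => c x • f x) p μ :=
  (hf.norm.const_mul C).of_le (hc.smul hf.1) <| .of_forall fun x => by
    have : 0 ≤ C := (abs_nonneg _).trans (hC x)
    rw [norm_smul, Real.norm_eq_abs, Real.norm_of_nonneg (mul_nonneg this (norm_nonneg _))]
    exact mul_le_mul_of_nonneg_right (hC x) (norm_nonneg _)

theorem memLp_smul_bdd [NormedSpace ℝ F] {p : ENNReal} {f : α → ℝ} (hf : MemLp f p μ) {c : α → F}
    (hc : AEStronglyMeasurable c μ) {C : ℝ} (hC : ∀ x, ‖c x‖ ≤ C) :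
    MemLp (fun x => f x • c x) p μ :=
  (hf.norm.const_mul C).of_le (hf.1.smul hc) <| .of_forall fun x => by
    have : 0 ≤ C := (norm_nonneg _).trans (hC x)
    rw [norm_smul, Real.norm_of_nonneg (mul_nonneg this (norm_nonneg _)), mul_comm]
    exact mul_le_mul_of_nonneg_right (hC x) (norm_nonneg _)

end CauchySchwarz

/-! ### Weak gradients under dilation and truncation. -/

section WeakGradient

variable {N : ℕ}

theorem inner_gradient_single (ψ : EuclideanSpace ℝ (Fin N) → ℝ) (x : EuclideanSpace ℝ (Fin N))
    (i : Fin N) : gradient ψ x i = fderiv ℝ ψ x (EuclideanSpace.single i 1) := by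
  have : inner ℝ (gradient ψ x) (EuclideanSpace.single i (1 : ℝ)) =
      fderiv ℝ ψ x (EuclideanSpace.single i 1) := by
    rw [gradient, InnerProductSpace.toDual_symm_apply]
  rw [← this, EuclideanSpace.inner_single_right]
  simp

theorem norm_gradient (ψ : EuclideanSpace ℝ (Fin N) → ℝ) (x : EuclideanSpace ℝ (Fin N)) :
    ‖gradient ψ x‖ = ‖fderiv ℝ ψ x‖ := by
  simp [gradient]

theorem continuous_gradient {ψ : EuclideanSpace ℝ (Fin N) → ℝ} (hψ : ContDiff ℝ (⊤ : ℕ∞) ψ) :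
    Continuous (gradient ψ) :=
  (InnerProductSpace.toDual ℝ _).symm.continuous.comp (hψ.continuous_fderiv (by simp))

theorem integral_comp_smul_euclidean {F : Type*} [NormedAddCommGroup F] [NormedSpace ℝ F]
    (f : EuclideanSpace ℝ (Fin N) → F) {r : ℝ} (hr : 0 < r) :
    ∫ x, f x = r ^ N • ∫ x, f (r • x) := by
  rw [Measure.integral_comp_smul_of_nonneg _ _ _ (hR := hr.le), finrank_euclideanSpace,
    Fintype.card_fin, smul_inv_smul₀ (by positivity)]

theorem MemH1With.comp_smul {u : EuclideanSpace ℝ (Fin N) → ℝ}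
    {G : EuclideanSpace ℝ (Fin N) → EuclideanSpace ℝ (Fin N)} (h : MemH1With u G) {r : ℝ}
    (hr : 0 < r) : MemH1With (fun x => u (r • x)) (fun x => r • G (r • x)) := by
  obtain ⟨hu, hG, -, -, hw⟩ := h
  have hu' := memLp_comp_smul hu hr.ne'
  have hG' := (memLp_comp_smul hG hr.ne').const_smul r
  refine ⟨hu', hG', hu'.locallyIntegrable (by simp), hG'.locallyIntegrable (by simp), ?_⟩
  intro η hη hηc i
  have hη' : ContDiff ℝ (⊤ : ℕ∞) fun x => η (r⁻¹ • x) := hη.comp (contDiff_const_smul _)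
  have hηc' : HasCompactSupport fun x => η (r⁻¹ • x) :=
    hηc.comp_homeomorph (Homeomorph.smulOfNeZero r⁻¹ (by positivity))
  have key := hw _ hη' hηc' i
  have hd : ∀ x, fderiv ℝ (fun x => η (r⁻¹ • x)) x = r⁻¹ • fderiv ℝ η (r⁻¹ • x) := by
    intro x
    exact fderiv_comp_smul r⁻¹
  rw [integral_comp_smul_euclidean _ hr, integral_comp_smul_euclidean (fun x => G x i * _) hr]
    at key
  simp only [hd, smul_smul, inv_mul_cancel₀ hr.ne', one_smul, smul_eq_mul,
    smul_apply] at key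
  rw [← mul_neg, mul_right_inj' (by positivity)] at key
  calc _ = r * ∫ x, u (r • x) * (r⁻¹ * fderiv ℝ η x (EuclideanSpace.single i 1)) := by
        rw [← integral_const_mul]
        congr 1 with x
        field_simp
    _ = _ := by
        rw [key, mul_neg, ← integral_const_mul]
        congr 2 with x
        simp [mul_assoc]

theorem HasCompactSupport.exists_norm_fderiv_le {ψ : EuclideanSpace ℝ (Fin N) → ℝ}
    (hψ : ContDiff ℝ (⊤ : ℕ∞) ψ) (hc : HasCompactSupport ψ) :
    ∃ C, 0 ≤ C ∧ ∀ x, |ψ x| ≤ C ∧ ‖fderiv ℝ ψ x‖ ≤ C := by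
  obtain ⟨A, hA⟩ := hψ.continuous.bounded_above_of_compact_support hc
  obtain ⟨B, hB⟩ := (hψ.continuous_fderiv (by simp)).bounded_above_of_compact_support
    (hc.fderiv (𝕜 := ℝ))
  refine ⟨max A B, (abs_nonneg _).trans ((hA 0).trans (le_max_left _ _)), fun x =>
    ⟨(hA x).trans (le_max_left _ _), (hB x).trans (le_max_right _ _)⟩⟩

/-- Weak product rule: the weak gradient of `u` is tested against `ψ * η`. With
`MemH1With.comp_smul` it makes truncated dilations admissible in the weak equation. -/
theorem MemH1With.smul_test {u ψ : EuclideanSpace ℝ (Fin N) → ℝ}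
    {G : EuclideanSpace ℝ (Fin N) → EuclideanSpace ℝ (Fin N)} (h : MemH1With u G)
    (hψ : ContDiff ℝ (⊤ : ℕ∞) ψ) (hc : HasCompactSupport ψ) :
    MemH1With (fun x => ψ x * u x) (fun x => ψ x • G x + u x • gradient ψ x) := by
  obtain ⟨hu, hG, hul, hGl, hw⟩ := h
  obtain ⟨C, -, hC⟩ := HasCompactSupport.exists_norm_fderiv_le hψ hc
  have hu' : MemLp (fun x => ψ x * u x) 2 :=
    memLp_bdd_smul hu hψ.continuous.aestronglyMeasurable fun x => (hC x).1
  have hG' : MemLp (fun x => ψ x • G x + u x • gradient ψ x) 2 :=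
    (memLp_bdd_smul hG hψ.continuous.aestronglyMeasurable fun x => (hC x).1).add
      (memLp_smul_bdd hu (continuous_gradient hψ).aestronglyMeasurable fun x =>
        (norm_gradient ψ x).trans_le (hC x).2)
  refine ⟨hu', hG', hu'.locallyIntegrable (by simp), hG'.locallyIntegrable (by simp), ?_⟩
  intro η hη hηc i
  have key := hw (fun x => ψ x * η x) (hψ.mul hη) hηc.mul_left i
  have hd : ∀ x, fderiv ℝ (fun x => ψ x * η x) x (EuclideanSpace.single i 1) =
      ψ x * fderiv ℝ η x (EuclideanSpace.single i 1) + η x * gradient ψ x i := by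
    intro x
    rw [fderiv_fun_mul (hψ.differentiable (by simp) x) (hη.differentiable (by simp) x)]
    simp [inner_gradient_single]
  have hgc : Continuous fun x => gradient ψ x i :=
    (EuclideanSpace.proj (𝕜 := ℝ) i).continuous.comp (continuous_gradient hψ)
  have hGi : LocallyIntegrable fun x => G x i := fun x => by
    obtain ⟨s, hs, hs'⟩ := hGl x
    exact ⟨s, hs, (EuclideanSpace.proj (𝕜 := ℝ) i).integrable_comp hs'⟩
  have hηd : Continuous fun x => fderiv ℝ η x (EuclideanSpace.single i 1) :=
    (hη.continuous_fderiv (by simp)).clm_apply continuous_const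
  have i1 : Integrable fun x => u x * (ψ x * fderiv ℝ η x (EuclideanSpace.single i 1)) :=
    hul.integrable_smul_right_of_hasCompactSupport (hψ.continuous.mul hηd)
      ((hηc.fderiv_apply (𝕜 := ℝ) _).mul_left)
  have i2 : Integrable fun x => u x * (η x * gradient ψ x i) :=
    hul.integrable_smul_right_of_hasCompactSupport (hη.continuous.mul hgc) hηc.mul_right
  have i3 : Integrable fun x => G x i * (ψ x * η x) :=
    hGi.integrable_smul_right_of_hasCompactSupport (hψ.continuous.mul hη.continuous) hηc.mul_left
  simp only [hd, mul_add] at key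
  rw [integral_add i1 i2] at key
  have e1 : ∫ x, ψ x * u x * fderiv ℝ η x (EuclideanSpace.single i 1) =
      ∫ x, u x * (ψ x * fderiv ℝ η x (EuclideanSpace.single i 1)) := by
    congr 1 with x
    ring
  have e2 : ∫ x, (ψ x • G x + u x • gradient ψ x) i * η x =
      (∫ x, G x i * (ψ x * η x)) + ∫ x, u x * (η x * gradient ψ x i) := by
    rw [← integral_add i3 i2]
    congr 1 with x
    simp
    ring
  rw [e1, e2]
  linarith

end WeakGradient

/-! ### Smooth radial cutoffs. -/

section Cutoff

variable {N : ℕ}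

/-- A smooth radially non-increasing function, equal to `1` on the ball of radius `R` and to `0`
outside the ball of radius `2 * R`. -/
noncomputable def cutoff (R : ℝ) (x : EuclideanSpace ℝ (Fin N)) : ℝ :=
  Real.smoothTransition (2 - ‖R⁻¹ • x‖ ^ 2)

theorem contDiff_cutoff (R : ℝ) :
    ContDiff ℝ (⊤ : ℕ∞) (cutoff R : EuclideanSpace ℝ (Fin N) → ℝ) :=
  Real.smoothTransition.contDiff.comp
    (contDiff_const.sub ((contDiff_norm_sq ℝ).comp (contDiff_const_smul _)))

theorem cutoff_nonneg (R : ℝ) (x : EuclideanSpace ℝ (Fin N)) : 0 ≤ cutoff R x :=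
  Real.smoothTransition.nonneg _

theorem cutoff_le_one (R : ℝ) (x : EuclideanSpace ℝ (Fin N)) : cutoff R x ≤ 1 :=
  Real.smoothTransition.le_one _

theorem abs_cutoff_le_one (R : ℝ) (x : EuclideanSpace ℝ (Fin N)) : |cutoff R x| ≤ 1 := by
  rw [abs_of_nonneg (cutoff_nonneg R x)]
  exact cutoff_le_one R x

theorem cutoff_eq_one {R : ℝ} (hR : 0 < R) {x : EuclideanSpace ℝ (Fin N)} (hx : ‖x‖ ≤ R) :
    cutoff R x = 1 := by
  refine Real.smoothTransition.one_of_one_le ?_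
  have h : ‖R⁻¹ • x‖ ≤ 1 := by
    rw [norm_smul, Real.norm_of_nonneg (by positivity)]
    exact (inv_mul_le_one₀ hR).2 hx
  nlinarith [norm_nonneg (R⁻¹ • x)]

theorem cutoff_eq_zero {R : ℝ} (hR : 0 < R) {x : EuclideanSpace ℝ (Fin N)} (hx : 2 * R ≤ ‖x‖) :
    cutoff R x = 0 := by
  refine Real.smoothTransition.zero_of_nonpos ?_
  have h : 2 ≤ ‖R⁻¹ • x‖ := by
    rw [norm_smul, Real.norm_of_nonneg (by positivity)]
    exact (le_inv_mul_iff₀ hR).2 (by linarith)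
  nlinarith

theorem hasCompactSupport_cutoff {R : ℝ} (hR : 0 < R) :
    HasCompactSupport (cutoff R : EuclideanSpace ℝ (Fin N) → ℝ) :=
  HasCompactSupport.intro (isCompact_closedBall 0 (2 * R)) fun x hx =>
    cutoff_eq_zero hR (by simpa using (not_le.1 (mt mem_closedBall_zero_iff.2 hx)).le)

theorem cutoff_smul_le {R r : ℝ} (hr : 1 ≤ r) (x : EuclideanSpace ℝ (Fin N)) :
    cutoff R (r • x) ≤ cutoff R x := by
  refine Real.smoothTransition.monotone ?_
  have : ‖R⁻¹ • x‖ ≤ ‖R⁻¹ • r • x‖ := by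
    rw [smul_comm, norm_smul r, Real.norm_of_nonneg (by linarith)]
    exact le_mul_of_one_le_left (norm_nonneg _) hr
  gcongr

/-- All cutoffs are rescalings of `cutoff 1`, so one derivative bound serves every `R`. -/
theorem exists_cutoff_lipschitz (N : ℕ) : ∃ L : ℝ, 0 ≤ L ∧ ∀ R : ℝ, 0 < R →
    (∀ x : EuclideanSpace ℝ (Fin N), ‖fderiv ℝ (cutoff R) x‖ ≤ L / R) ∧
    ∀ x y : EuclideanSpace ℝ (Fin N), |cutoff R x - cutoff R y| ≤ L / R * ‖x - y‖ := by
  obtain ⟨L, hL0, hL⟩ := HasCompactSupport.exists_norm_fderiv_le (N := N) (contDiff_cutoff 1)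
    (hasCompactSupport_cutoff one_pos)
  refine ⟨L, hL0, fun R hR => ?_⟩
  have h1 : ∀ x : EuclideanSpace ℝ (Fin N), ‖fderiv ℝ (cutoff R) x‖ ≤ L / R := by
    intro x
    have e : (cutoff R : EuclideanSpace ℝ (Fin N) → ℝ) = fun x => cutoff 1 (R⁻¹ • x) := by
      ext x
      simp [cutoff]
    rw [e, fderiv_comp_smul (f := cutoff 1), norm_smul, Real.norm_of_nonneg (by positivity),
      div_eq_inv_mul]
    exact mul_le_mul_of_nonneg_left (hL _).2 (by positivity)
  refine ⟨h1, fun x y => ?_⟩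
  have := Convex.norm_image_sub_le_of_norm_fderiv_le (𝕜 := ℝ) (f := cutoff R) (s := Set.univ)
    (fun z _ => (contDiff_cutoff R).differentiable (by simp) z) (fun z _ => h1 z) convex_univ
    (Set.mem_univ y) (Set.mem_univ x)
  simpa using this

end Cutoff

/-! ### L² bounds by duality. -/

section Duality

/-- By density of test functions in L² the bound extends to every L² function, in particular to `W`
itself. -/
theorem integral_sq_le_of_forall_test {E : Type*} [NormedAddCommGroup E] [NormedSpace ℝ E]
    [FiniteDimensional ℝ E] [MeasurableSpace E] [BorelSpace E] {μ : Measure E}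
    [IsFiniteMeasureOnCompacts μ] {W : E → ℝ} (hW : MemLp W 2 μ) {K : ℝ} (hK : 0 ≤ K)
    (h : ∀ η : E → ℝ, ContDiff ℝ (⊤ : ℕ∞) η → HasCompactSupport η →
      |∫ x, W x * η x ∂μ| ≤ K * √(∫ x, η x ^ 2 ∂μ)) :
    ∫ x, W x ^ 2 ∂μ ≤ K ^ 2 := by
  have hnorm : ∀ f : Lp ℝ 2 μ, ‖f‖ = √(∫ x, f x ^ 2 ∂μ) := by
    intro f
    rw [← Real.sqrt_sq (norm_nonneg f), ← real_inner_self_eq_norm_sq, L2.inner_def]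
    simp [sq]
  set f := hW.toLp W with hf
  have key : ∀ g : Lp ℝ 2 μ, |inner ℝ f g| ≤ K * ‖g‖ := by
    intro g
    refine isClosed_property (p := fun g : Lp ℝ 2 μ => |inner ℝ f g| ≤ K * ‖g‖)
      (e := ((↑) : {f : Lp ℝ 2 μ | ∃ g : E → ℝ, f =ᵐ[μ] g ∧ HasCompactSupport g ∧
        ContDiff ℝ (⊤ : ℕ∞) g} → Lp ℝ 2 μ))
      (Lp.dense_hasCompactSupport_contDiff (by simp)).denseRange_val
      (isClosed_le (by fun_prop) (by fun_prop)) ?_ g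
    rintro ⟨g, η, hg, hηc, hη⟩
    have e1 : inner ℝ f g = ∫ x, W x * η x ∂μ := by
      rw [L2.inner_def]
      refine integral_congr_ae ?_
      filter_upwards [hg, hW.coeFn_toLp] with x h1 h2
      simp [hf, h1, h2, mul_comm]
    have e2 : ‖g‖ = √(∫ x, η x ^ 2 ∂μ) := by
      rw [hnorm]
      congr 1
      refine integral_congr_ae ?_
      filter_upwards [hg] with x h1
      rw [h1]
    simp only [e1, e2]
    exact h η hη hηc
  have h1 := key f
  rw [real_inner_self_eq_norm_sq, abs_of_nonneg (sq_nonneg _)] at h1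
  have h2 : ‖f‖ ≤ K := by
    by_contra! hc
    nlinarith [norm_nonneg f]
  have h3 : ∫ x, W x ^ 2 ∂μ = ‖f‖ ^ 2 := by
    rw [hnorm, Real.sq_sqrt (integral_nonneg fun x => sq_nonneg _)]
    refine integral_congr_ae ?_
    filter_upwards [hW.coeFn_toLp] with x h1
    rw [h1]
  rw [h3]
  gcongr

end Duality

/-! ### Difference estimate for dilations in H^1. -/

section Difference

variable {N : ℕ}

/-- The test functions y_i ζ have ∂_i(y_i ζ) = ζ + y_i ∂_i ζ; summing over i produces the Euler
operator. -/
theorem HasWeakGradient.integral_mul_euler {v : EuclideanSpace ℝ (Fin N) → ℝ}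
    {g : EuclideanSpace ℝ (Fin N) → EuclideanSpace ℝ (Fin N)} (h : HasWeakGradient v g)
    {ζ : EuclideanSpace ℝ (Fin N) → ℝ} (hζ : ContDiff ℝ (⊤ : ℕ∞) ζ) (hc : HasCompactSupport ζ) :
    ∫ y, v y * (N * ζ y + fderiv ℝ ζ y y) = - ∫ y, inner ℝ (g y) y * ζ y := by
  obtain ⟨hv, hg, hw⟩ := h
  have hgi : ∀ i, LocallyIntegrable fun x => g x i := fun i x => by
    obtain ⟨s, hs, hs'⟩ := hg x
    exact ⟨s, hs, (EuclideanSpace.proj (𝕜 := ℝ) i).integrable_comp hs'⟩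
  have hci : ∀ i : Fin N, ContDiff ℝ (⊤ : ℕ∞) fun y : EuclideanSpace ℝ (Fin N) => y i :=
    fun i => (EuclideanSpace.proj (𝕜 := ℝ) i).contDiff
  have hd : ∀ (i : Fin N) (y : EuclideanSpace ℝ (Fin N)),
      fderiv ℝ (fun y => y i * ζ y) y (EuclideanSpace.single i 1) =
        ζ y + y i * fderiv ℝ ζ y (EuclideanSpace.single i 1) := by
    intro i y
    rw [fderiv_fun_mul ((hci i).differentiable (by simp) y) (hζ.differentiable (by simp) y)]
    have : fderiv ℝ (fun y : EuclideanSpace ℝ (Fin N) => y i) y = EuclideanSpace.proj i :=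
      (EuclideanSpace.proj (𝕜 := ℝ) i).fderiv
    simp [this]
    ring
  have hsum : ∀ y, v y * (N * ζ y + fderiv ℝ ζ y y) =
      ∑ i, v y * (ζ y + y i * fderiv ℝ ζ y (EuclideanSpace.single i 1)) := by
    intro y
    rw [← Finset.mul_sum, Finset.sum_add_distrib]
    congr 2
    · simp
    · have := congrArg (fderiv ℝ ζ y) ((EuclideanSpace.basisFun (Fin N) ℝ).sum_repr y).symm
      simpa [map_sum] using this
  have hsum' : ∀ y, inner ℝ (g y) y * ζ y = ∑ i, g y i * (y i * ζ y) := by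
    intro y
    rw [PiLp.inner_apply, Finset.sum_mul]
    refine Finset.sum_congr rfl fun i _ => ?_
    simp
    ring
  simp_rw [hsum, hsum']
  rw [integral_finsetSum, integral_finsetSum, ← Finset.sum_neg_distrib]
  · refine Finset.sum_congr rfl fun i _ => ?_
    rw [← hw _ ((hci i).mul hζ) hc.mul_left i]
    simp_rw [hd]
  · intro i _
    exact (hgi i).integrable_smul_right_of_hasCompactSupport
      ((hci i).continuous.mul hζ.continuous) hc.mul_left
  · intro i _
    exact hv.integrable_smul_right_of_hasCompactSupport
      (hζ.continuous.add ((hci i).continuous.mul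
        ((hζ.continuous_fderiv (by simp)).clm_apply continuous_const)))
      (hc.add (hc.fderiv_apply (𝕜 := ℝ) _).mul_left)

end Difference

section Difference

variable {N : ℕ}

/-- The dilation sits on the smooth factor, so differentiation under the integral asks only local
integrability of `v`. The Euler identity for η(τ·) then moves the derivative onto `v`. -/
theorem HasWeakGradient.hasDerivAt_integral_dilation {v : EuclideanSpace ℝ (Fin N) → ℝ}
    {g : EuclideanSpace ℝ (Fin N) → EuclideanSpace ℝ (Fin N)} (h : HasWeakGradient v g)
    {η : EuclideanSpace ℝ (Fin N) → ℝ} (hη : ContDiff ℝ (⊤ : ℕ∞) η) (hc : HasCompactSupport η)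
    {τ : ℝ} (hτ : 0 < τ) :
    HasDerivAt (fun τ : ℝ => ∫ y, v y * (τ ^ N * η (τ • y)))
      (-(τ ^ N * τ⁻¹ * ∫ y, inner ℝ (g y) y * η (τ • y))) τ := by
  obtain ⟨C, hC0, hC⟩ := HasCompactSupport.exists_norm_fderiv_le hη hc
  obtain ⟨ρ, hρ⟩ := hc.isCompact.isBounded.subset_closedBall 0
  have hηs : ∀ x, ρ < ‖x‖ → η x = 0 ∧ fderiv ℝ η x = 0 := fun x hx => by
    have hx' : x ∉ tsupport η := fun h => by
      have := mem_closedBall_zero_iff.1 (hρ h)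
      linarith
    refine ⟨image_eq_zero_of_notMem_tsupport hx', ?_⟩
    by_contra hne
    exact hx' (support_fderiv_subset ℝ hne)
  have hdil : ∀ s : ℝ, s ≠ 0 → HasCompactSupport fun y : EuclideanSpace ℝ (Fin N) => η (s • y) :=
    fun s hs => hc.comp_homeomorph (Homeomorph.smulOfNeZero s hs)
  have hdilc : ∀ s : ℝ, ContDiff ℝ (⊤ : ℕ∞) fun y : EuclideanSpace ℝ (Fin N) => η (s • y) :=
    fun s => hη.comp (contDiff_const_smul _)
  have hvm : AEStronglyMeasurable v := h.1.aestronglyMeasurable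
  set F' : ℝ → EuclideanSpace ℝ (Fin N) → ℝ := fun s y =>
    v y * (N * s ^ (N - 1) * η (s • y) + s ^ N * fderiv ℝ η (s • y) y) with hF'
  have hcF' : ∀ s, Continuous fun y : EuclideanSpace ℝ (Fin N) =>
      (N * s ^ (N - 1) * η (s • y) + s ^ N * fderiv ℝ η (s • y) y) := fun s =>
    (continuous_const.mul (hdilc s).continuous).add (continuous_const.mul
      (((hη.continuous_fderiv (by simp)).comp (continuous_const_smul s)).clm_apply continuous_id))
  -- For s > τ/2 the function η(s·) vanishes outside the ball of radius `ρ'`; `K` bounds the other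
  -- factor there, using s < 2τ.
  set ρ' := 2 * ρ / τ with hρ'
  set K := N * (2 * τ) ^ (N - 1) * C + (2 * τ) ^ N * (C * |ρ'|) with hK
  obtain ⟨-, key⟩ := hasDerivAt_integral_of_dominated_loc_of_deriv_le
    (μ := (volume : Measure (EuclideanSpace ℝ (Fin N))))
    (F := fun (s : ℝ) y => v y * (s ^ N * η (s • y))) (F' := F') (x₀ := τ)
    (s := Set.Ioo (τ / 2) (2 * τ))
    (bound := (Metric.closedBall 0 ρ').indicator fun y => ‖v y‖ * K)
    (Ioo_mem_nhds (by linarith) (by linarith))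
    (.of_forall fun s => hvm.mul (continuous_const.mul (hdilc s).continuous).aestronglyMeasurable)
    (h.1.integrable_smul_right_of_hasCompactSupport (continuous_const.mul (hdilc τ).continuous)
      (hdil τ hτ.ne').mul_left)
    (hvm.mul (hcF' τ).aestronglyMeasurable)
    (.of_forall fun y s hs => by
      have hs0 : 0 < s := by linarith [hs.1]
      by_cases hy : y ∈ Metric.closedBall 0 ρ'
      · rw [Set.indicator_of_mem hy, hF']
        beta_reduce
        rw [norm_mul]
        refine mul_le_mul_of_nonneg_left ?_ (norm_nonneg _)
        refine (norm_add_le _ _).trans ?_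
        rw [norm_mul _ (η _), norm_mul (s ^ N), Real.norm_of_nonneg (by positivity : 0 ≤ (N : ℝ) * s ^ (N - 1)),
          Real.norm_of_nonneg (by positivity : 0 ≤ s ^ N), hK]
        have h1 := hC (s • y)
        have h2 : ‖y‖ ≤ |ρ'| := (mem_closedBall_zero_iff.1 hy).trans (le_abs_self _)
        have h3 : s ≤ 2 * τ := hs.2.le
        have h4 : ‖fderiv ℝ η (s • y) y‖ ≤ C * |ρ'| :=
          (ContinuousLinearMap.le_opNorm _ _).trans
            (mul_le_mul h1.2 h2 (norm_nonneg _) hC0)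
        have h5 : ‖η (s • y)‖ ≤ C := h1.1
        gcongr
      · have hlt : ρ < ‖s • y‖ := by
          rw [norm_smul, Real.norm_of_nonneg hs0.le]
          have h1 : ρ' < ‖y‖ := not_le.1 (mt mem_closedBall_zero_iff.2 hy)
          rw [hρ', div_lt_iff₀ hτ] at h1
          nlinarith [norm_nonneg y, hs.1]
        simp [hF', hηs _ hlt, Set.indicator_of_notMem hy])
    ((integrable_indicator_iff measurableSet_closedBall).2
      ((h.1.integrableOn_isCompact (isCompact_closedBall 0 ρ')).norm.mul_const K))
    (.of_forall fun y s _ => by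
      have h1 : HasDerivAt (fun s : ℝ => s • y) y s := by
        simpa using (hasDerivAt_id s).smul_const y
      have h2 : HasDerivAt (fun s : ℝ => η (s • y)) (fderiv ℝ η (s • y) y) s :=
        (hη.differentiable (by simp) (s • y)).hasFDerivAt.comp_hasDerivAt s h1
      exact ((hasDerivAt_pow N s).mul h2).const_mul (v y))
  refine key.congr_deriv ?_
  have e := h.integral_mul_euler (hdilc τ) (hdil τ hτ.ne')
  have hfd : ∀ y, fderiv ℝ (fun y => η (τ • y)) y = τ • fderiv ℝ η (τ • y) :=
    fun y => fderiv_comp_smul τ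
  simp only [hfd, smul_apply, smul_eq_mul] at e
  have e2 : ∀ y, F' τ y = (τ ^ N * τ⁻¹) *
      (v y * (N * η (τ • y) + τ * fderiv ℝ η (τ • y) y)) := by
    intro y
    -- The truncated exponent `N - 1` is harmless at `N = 0`, where its coefficient vanishes.
    rcases Nat.eq_zero_or_pos N with h0 | h0
    · simp only [hF', h0]
      field_simp
      simp
      ring
    · have : τ ^ N = τ ^ (N - 1) * τ := by rw [← pow_succ, Nat.sub_add_cancel h0]
      simp only [hF', this]
      field_simp
  simp_rw [e2]
  rw [integral_const_mul, e]
  ring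

/-- By duality it suffices to pair with a test function. After a change of variables the pairing is
a difference of ∫ v τ^N η(τ·) between τ = r⁻¹ and τ = 1, to which the mean value inequality applies.
-/
theorem exists_integral_sub_dilation_sq_le (N : ℕ) : ∃ A : ℝ, 0 ≤ A ∧
    ∀ (v : EuclideanSpace ℝ (Fin N) → ℝ) (g : EuclideanSpace ℝ (Fin N) → EuclideanSpace ℝ (Fin N)),
      MemH1With v g → ∀ R r : ℝ, 0 < R → r ∈ Set.Icc (1 / 2 : ℝ) 2 →
        ∫ x, (cutoff R x * (v (r • x) - v x)) ^ 2 ≤ (A * R * |r - 1| * √(∫ x, ‖g x‖ ^ 2)) ^ 2 := by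
  -- For τ in [1/2, 2]: `2 ^ N` bounds τ^N, `2` bounds τ⁻¹, `4` comes from the support radius 4R of
  -- η(τ·), and `√(2 ^ N)` from its L² norm. The further factor 2 below comes from |r⁻¹ - 1| ≤ 2|r -
  -- 1|.
  set B : ℝ := 2 ^ N * 2 * (4 * √(2 ^ N)) with hB
  refine ⟨B * 2, by positivity, fun v g h R r hR hr => ?_⟩
  have hr0 : 0 < r := by linarith [hr.1]
  obtain ⟨hv, hg, hw⟩ := h
  have hvr := memLp_comp_smul hv hr0.ne'
  refine integral_sq_le_of_forall_test (memLp_bdd_smul (hvr.sub hv)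
    (contDiff_cutoff R).continuous.aestronglyMeasurable (abs_cutoff_le_one R)) (by positivity) ?_
  intro η₀ hη₀ hc₀
  set η : EuclideanSpace ℝ (Fin N) → ℝ := fun x => cutoff R x * η₀ x with hηdef
  have hη : ContDiff ℝ (⊤ : ℕ∞) η := (contDiff_cutoff R).mul hη₀
  have hc : HasCompactSupport η := hc₀.mul_left
  have hη2 : MemLp η 2 := hη.continuous.memLp_of_hasCompactSupport hc
  have hη₀2 : MemLp η₀ 2 := hη₀.continuous.memLp_of_hasCompactSupport hc₀
  have hηle : √(∫ x, η x ^ 2) ≤ √(∫ x, η₀ x ^ 2) := by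
    refine Real.sqrt_le_sqrt (integral_mono (by simpa using integrable_norm_sq hη2)
      (by simpa using integrable_norm_sq hη₀2) fun x => ?_)
    have := abs_cutoff_le_one R x
    simp only [hηdef, mul_pow]
    have h1 : cutoff R x ^ 2 ≤ 1 := (sq_le_one_iff_abs_le_one _).2 this
    nlinarith [sq_nonneg (η₀ x)]
  have hderiv : ∀ τ ∈ Set.Icc (1 / 2 : ℝ) 2,
      ‖-(τ ^ N * τ⁻¹ * ∫ y, inner ℝ (g y) y * η (τ • y))‖ ≤
        B * R * √(∫ x, ‖g x‖ ^ 2) * √(∫ x, η x ^ 2) := by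
    intro τ hτ
    have hτ0 : 0 < τ := by linarith [hτ.1]
    have hητ : MemLp (fun y => η (τ • y)) 2 := memLp_comp_smul hη2 hτ0.ne'
    have h1 : ‖∫ y, inner ℝ (g y) y * η (τ • y)‖ ≤
        4 * R * (√(∫ x, ‖g x‖ ^ 2) * √(∫ y, η (τ • y) ^ 2)) := by
      have h2 := integral_norm_mul_norm_le hg hητ
      simp only [Real.norm_eq_abs, sq_abs] at h2
      refine (norm_integral_le_of_norm_le
        ((integrable_norm_mul_norm hg hητ).const_mul (4 * R)) (.of_forall fun y => ?_)).trans ?_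
      · rw [norm_mul]
        by_cases hy : ‖y‖ ≤ 4 * R
        · have := norm_inner_le_norm (𝕜 := ℝ) (g y) y
          have h3 : ‖g y‖ * ‖y‖ ≤ ‖g y‖ * (4 * R) := by gcongr
          calc _ ≤ ‖g y‖ * (4 * R) * ‖η (τ • y)‖ := by gcongr; exact this.trans h3
            _ = _ := by ring
        · have : η (τ • y) = 0 := by
            simp only [hηdef]
            rw [cutoff_eq_zero hR, zero_mul]
            rw [norm_smul, Real.norm_of_nonneg hτ0.le]
            nlinarith [hτ.1]
          simp [this]
      · rw [integral_const_mul]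
        exact mul_le_mul_of_nonneg_left h2 (by positivity)
    have h2 : √(∫ y, η (τ • y) ^ 2) ≤ √(2 ^ N) * √(∫ x, η x ^ 2) := by
      rw [← Real.sqrt_mul (by positivity)]
      refine Real.sqrt_le_sqrt ?_
      rw [integral_comp_smul_euclidean (fun x => η x ^ 2) hτ0, smul_eq_mul, ← mul_assoc,
        ← mul_pow]
      exact le_mul_of_one_le_left (integral_nonneg fun x => sq_nonneg _)
        (one_le_pow₀ (by linarith [hτ.1]))
    have h3 : τ ^ N ≤ 2 ^ N := pow_le_pow_left₀ hτ0.le hτ.2 N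
    have h4 : τ⁻¹ ≤ 2 := inv_le_of_inv_le₀ (by norm_num) (by linarith [hτ.1])
    rw [norm_neg, norm_mul, Real.norm_of_nonneg (by positivity : 0 ≤ τ ^ N * τ⁻¹)]
    calc _ ≤ 2 ^ N * 2 * (4 * R * (√(∫ x, ‖g x‖ ^ 2) * (√(2 ^ N) * √(∫ x, η x ^ 2)))) := by
          gcongr
          exact h1.trans (by gcongr)
      _ = _ := by rw [hB]; ring
  have hmv := (convex_Icc (1 / 2 : ℝ) 2).norm_image_sub_le_of_norm_hasDerivWithin_le
    (f := fun τ : ℝ => ∫ y, v y * (τ ^ N * η (τ • y)))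
    (fun τ hτ => (hw.hasDerivAt_integral_dilation hη hc
      (by linarith [hτ.1] : 0 < τ)).hasDerivWithinAt) hderiv
    (show (1 : ℝ) ∈ Set.Icc (1 / 2 : ℝ) 2 by norm_num)
    (show r⁻¹ ∈ Set.Icc (1 / 2 : ℝ) 2 from
      ⟨by rw [one_div]; exact inv_anti₀ hr0 hr.2,
        inv_le_of_inv_le₀ (by norm_num) (by linarith [hr.1])⟩)
  have hF : ∫ x, cutoff R x * (v (r • x) - v x) * η₀ x =
      (∫ y, v y * (r⁻¹ ^ N * η (r⁻¹ • y))) - ∫ y, v y * ((1 : ℝ) ^ N * η ((1 : ℝ) • y)) := by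
    rw [integral_comp_smul_euclidean (fun y => v y * (r⁻¹ ^ N * η (r⁻¹ • y))) hr0, smul_eq_mul,
      ← integral_const_mul, ← integral_sub]
    · congr 1 with x
      rw [inv_smul_smul₀ hr0.ne', one_smul, one_pow, inv_pow]
      have : r ^ N ≠ 0 := by positivity
      field_simp
      simp only [hηdef]
      ring
    · refine Integrable.const_mul ?_ _
      have : Integrable fun x => v (r • x) * (r⁻¹ ^ N * η x) :=
        hvr.integrable_mul (hη2.const_mul _)
      simpa [inv_smul_smul₀ hr0.ne'] using this
    · simp only [one_smul, one_pow, one_mul]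
      exact hv.integrable_mul hη2
  have hr1 : |r⁻¹ - 1| ≤ 2 * |r - 1| := by
    have : r⁻¹ - 1 = r⁻¹ * (1 - r) := by field_simp
    rw [this, abs_mul, abs_of_pos (by positivity), abs_sub_comm]
    gcongr
    exact inv_le_of_inv_le₀ (by norm_num) (by linarith [hr.1])
  change |∫ x, cutoff R x * (v (r • x) - v x) * η₀ x| ≤ _
  rw [hF, ← Real.norm_eq_abs]
  refine hmv.trans ?_
  rw [Real.norm_eq_abs]
  calc _ ≤ B * R * √(∫ x, ‖g x‖ ^ 2) * √(∫ x, η₀ x ^ 2) * (2 * |r - 1|) := by gcongr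
    _ = _ := by ring

end Difference

/-! ### Young-type inequalities for powers. -/

section PowerInequalities

theorem rpow_le_two_pow {r e : ℝ} {d : ℕ} (h1 : 1 ≤ r) (h2 : r ≤ 2) (he : e ≤ d) :
    r ^ e ≤ 2 ^ d := by
  calc r ^ e ≤ r ^ (d : ℝ) := Real.rpow_le_rpow_of_exponent_le h1 he
    _ = r ^ d := Real.rpow_natCast r d
    _ ≤ 2 ^ d := pow_le_pow_left₀ (by linarith) h2 d

theorem rpow_inv_mul_self {m a : ℝ} (hm : 1 < m) (ha : 0 ≤ a) :
    a ^ (1 / m) * a = a ^ ((m + 1) / m) := by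
  have : (m + 1) / m = 1 / m + 1 := by field_simp; ring
  rw [this, Real.rpow_add_one' ha (by positivity)]

theorem rpow_inv_mul_le {m a b : ℝ} (hm : 1 < m) (ha : 0 ≤ a) (hb : 0 ≤ b) :
    a ^ (1 / m) * b ≤
      m / (m + 1) * b ^ ((m + 1) / m) + (1 - m / (m + 1)) * a ^ ((m + 1) / m) := by
  have hpq : (m + 1).HolderConjugate ((m + 1) / m) := by
    rw [Real.holderConjugate_iff]
    refine ⟨by linarith, ?_⟩
    field_simp
    ring
  have h := Real.young_inequality_of_nonneg (Real.rpow_nonneg ha (1 / m)) hb hpq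
  rw [← Real.rpow_mul ha] at h
  have e1 : 1 / m * (m + 1) = (m + 1) / m := by ring
  rw [e1] at h
  refine h.trans (le_of_eq ?_)
  field_simp
  ring

theorem abs_rpow_sub_rpow_le {s a b : ℝ} (hs0 : 0 ≤ s) (hs1 : s ≤ 1) (ha : 0 ≤ a) (hb : 0 ≤ b) :
    |a ^ s - b ^ s| ≤ |a - b| ^ s := by
  wlog hab : b ≤ a generalizing a b
  · rw [abs_sub_comm, abs_sub_comm a b]
    exact this hb ha (le_of_not_ge hab)
  have h := Real.rpow_add_le_add_rpow (sub_nonneg.2 hab) hb hs0 hs1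
  rw [sub_add_cancel] at h
  rw [abs_of_nonneg (sub_nonneg.2 hab),
    abs_of_nonneg (sub_nonneg.2 (Real.rpow_le_rpow hb hab hs0))]
  linarith

/-- Reverse Young inequality: expand (a^(1/m) - b^(1/m))(a - b), which is at most |a - b|^((m+1)/m)
by Hölder continuity of the root, and apply Young's inequality to the other cross term b^(1/m) a.
The remainder is superlinear in a - b. -/
theorem le_rpow_inv_mul {m a b : ℝ} (hm : 1 < m) (ha : 0 ≤ a) (hb : 0 ≤ b) :
    m / (m + 1) * b ^ ((m + 1) / m) + (1 - m / (m + 1)) * a ^ ((m + 1) / m)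
      - |a - b| ^ ((m + 1) / m) ≤ a ^ (1 / m) * b := by
  have h1 := rpow_inv_mul_le hm hb ha
  have h2 : |a ^ (1 / m) - b ^ (1 / m)| ≤ |a - b| ^ (1 / m) :=
    abs_rpow_sub_rpow_le (by positivity) (by rw [div_le_one (by linarith)]; exact hm.le) ha hb
  have h3 : (a ^ (1 / m) - b ^ (1 / m)) * (a - b) ≤ |a - b| ^ ((m + 1) / m) := by
    rw [← rpow_inv_mul_self hm (abs_nonneg _)]
    refine (le_abs_self _).trans ?_
    rw [abs_mul]
    gcongr
  rw [← rpow_inv_mul_self hm ha, ← rpow_inv_mul_self hm hb] at *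
  nlinarith

/-- Splitting at |w| = t turns L² control of `w` into control of |w|^p on bounded sets; `t` will be
r - 1. -/
theorem abs_rpow_le_add {p t w : ℝ} (hp0 : 0 ≤ p) (hp : p ≤ 2) (ht : 0 < t) :
    |w| ^ p ≤ t ^ p + t ^ (p - 2) * w ^ 2 := by
  rcases le_or_gt |w| t with h | h
  · have : |w| ^ p ≤ t ^ p := by gcongr
    have : 0 ≤ t ^ (p - 2) * w ^ 2 := by positivity
    linarith
  · have h1 : |w| ^ p = |w| ^ (p - 2) * w ^ 2 := by
      rw [← sq_abs w, ← Real.rpow_natCast, ← Real.rpow_add (ht.trans h)]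
      congr 1
      push_cast
      ring
    have h2 : |w| ^ (p - 2) ≤ t ^ (p - 2) :=
      Real.rpow_le_rpow_of_nonpos ht h.le (by linarith)
    have : 0 ≤ t ^ p := by positivity
    rw [h1]
    nlinarith [sq_nonneg w]

end PowerInequalities

/-! ### Gradient and potential terms. -/

section Dilation

variable {N : ℕ}

/-- The complement of the ball of radius `R / 2`. -/
def farSet (N : ℕ) (R : ℝ) : Set (EuclideanSpace ℝ (Fin N)) := {x | R / 2 ≤ ‖x‖}

theorem measurableSet_farSet (N : ℕ) (R : ℝ) : MeasurableSet (farSet N R) :=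
  (isClosed_le continuous_const continuous_norm).measurableSet

/-- `L` is a scale-invariant Lipschitz constant for all the cutoff functions. -/
def IsCutoffConstant (N : ℕ) (L : ℝ) : Prop :=
  0 ≤ L ∧ ∀ R : ℝ, 0 < R →
    (∀ x : EuclideanSpace ℝ (Fin N), ‖fderiv ℝ (cutoff R) x‖ ≤ L / R) ∧
    ∀ x y : EuclideanSpace ℝ (Fin N), |cutoff R x - cutoff R y| ≤ L / R * ‖x - y‖

/-- Since r ≤ 2, both values are 1 when ‖x‖ < R/2, and both are 0 when ‖x‖ ≥ 2R. In between, ‖x - r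
x‖ ≤ 2R(r - 1), so `R` drops out of the bound. -/
theorem abs_cutoff_sub_cutoff_smul_le {L R r : ℝ} (hL : IsCutoffConstant N L) (hR : 0 < R)
    (h1 : 1 ≤ r) (h2 : r ≤ 2) (x : EuclideanSpace ℝ (Fin N)) :
    |cutoff R x - cutoff R (r • x)| ≤ (farSet N R).indicator (fun _ => 2 * L * (r - 1)) x := by
  by_cases hx : x ∈ farSet N R
  · rw [Set.indicator_of_mem hx]
    rcases le_or_gt (2 * R) ‖x‖ with h | h
    · rw [cutoff_eq_zero hR h, cutoff_eq_zero hR]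
      · have := hL.1
        simp only [sub_self, abs_zero]
        exact mul_nonneg (by positivity) (by linarith)
      · rw [norm_smul, Real.norm_of_nonneg (by linarith)]
        nlinarith [norm_nonneg x]
    · refine ((hL.2 R hR).2 x (r • x)).trans ?_
      have e : x - r • x = (1 - r) • x := by rw [sub_smul, one_smul]
      rw [e, norm_smul, Real.norm_eq_abs, abs_sub_comm, abs_of_nonneg (by linarith)]
      calc L / R * ((r - 1) * ‖x‖) ≤ L / R * ((r - 1) * (2 * R)) := by
            have := hL.1
            have : 0 ≤ r - 1 := by linarith
            gcongr
        _ = _ := by field_simp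
  · have hx' : ‖x‖ < R / 2 := not_le.1 hx
    rw [Set.indicator_of_notMem hx, cutoff_eq_one hR (by linarith), cutoff_eq_one hR, sub_self,
      abs_zero]
    rw [norm_smul, Real.norm_of_nonneg (by linarith)]
    nlinarith [norm_nonneg x]

theorem integral_norm_sq_comp_smul_le {F : Type*} [NormedAddCommGroup F]
    (g : EuclideanSpace ℝ (Fin N) → F) {r : ℝ} (hr : 1 ≤ r) :
    ∫ x, ‖g (r • x)‖ ^ 2 ≤ ∫ x, ‖g x‖ ^ 2 := by
  rw [integral_comp_smul_euclidean (fun x => ‖g x‖ ^ 2) (by linarith : 0 < r), smul_eq_mul]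
  exact le_mul_of_one_le_left (integral_nonneg fun x => sq_nonneg _) (one_le_pow₀ hr)

/-- This fixes θ: substituting x ↦ r x in the second integral gives both terms the same prefactor
r^(N/2) and the same inner product. Only `cutoff R x - cutoff R (r • x)` survives, and it lives in
the far region. -/
theorem abs_integral_cutoff_inner_dilation_le
    {g : EuclideanSpace ℝ (Fin N) → EuclideanSpace ℝ (Fin N)} (hg : MemLp g 2)
    {L R r θ : ℝ} (hL : IsCutoffConstant N L) (hR : 0 < R) (h1 : 1 ≤ r) (h2 : r ≤ 2)
    (hθ : θ = N / 2 - 1) :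
    |r ^ θ * (r * ∫ x, cutoff R x * inner ℝ (g x) (g (r • x)))
      - r ^ (-θ) * (r⁻¹ * ∫ x, cutoff R x * inner ℝ (g x) (g (r⁻¹ • x)))| ≤
      2 ^ (N + 1) * (2 * L * (r - 1)) *
        (√(∫ x in farSet N R, ‖g x‖ ^ 2) * √(∫ x, ‖g x‖ ^ 2)) := by
  have hr : 0 < r := by linarith
  have hgr := memLp_comp_smul hg hr.ne'
  have hL0 := hL.1
  have hr1 : 0 ≤ r - 1 := by linarith
  have hint : ∀ s : ℝ, Integrable fun x => cutoff R (s • x) * inner ℝ (g x) (g (r • x)) := by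
    intro s
    refine (integrable_inner hg hgr).bdd_mul (c := 1)
      ((contDiff_cutoff R).continuous.comp (continuous_const_smul s)).aestronglyMeasurable
      (.of_forall fun x => abs_cutoff_le_one R _)
  have hint1 : Integrable fun x => cutoff R x * inner ℝ (g x) (g (r • x)) := by
    simpa using hint 1
  have e : r ^ θ * (r * ∫ x, cutoff R x * inner ℝ (g x) (g (r • x)))
      - r ^ (-θ) * (r⁻¹ * ∫ x, cutoff R x * inner ℝ (g x) (g (r⁻¹ • x))) =
      r ^ ((N : ℝ) / 2) *
        ∫ x, (cutoff R x - cutoff R (r • x)) * inner ℝ (g x) (g (r • x)) := by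
    have c1 : r ^ θ * r = r ^ ((N : ℝ) / 2) := by
      rw [← Real.rpow_add_one hr.ne', hθ]
      congr 1
      ring
    have c2 : r ^ (-θ) * r⁻¹ * r ^ N = r ^ ((N : ℝ) / 2) := by
      rw [← Real.rpow_neg_one r, ← Real.rpow_natCast, ← Real.rpow_add hr, ← Real.rpow_add hr, hθ]
      congr 1
      ring
    rw [integral_comp_smul_euclidean
      (fun x => cutoff R x * inner ℝ (g x) (g (r⁻¹ • x))) hr, smul_eq_mul]
    simp_rw [inv_smul_smul₀ hr.ne', sub_mul]
    rw [integral_sub hint1 (hint r), mul_sub, ← mul_assoc, ← mul_assoc, ← mul_assoc, c1, c2]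
    simp_rw [real_inner_comm]
  rw [e, abs_mul, abs_of_nonneg (by positivity)]
  have hind : Integrable ((farSet N R).indicator fun x => ‖g x‖ * ‖g (r • x)‖) :=
    (integrable_norm_mul_norm hg hgr).indicator (measurableSet_farSet N R)
  have hb : |∫ x, (cutoff R x - cutoff R (r • x)) * inner ℝ (g x) (g (r • x))| ≤
      2 * L * (r - 1) * ∫ x in farSet N R, ‖g x‖ * ‖g (r • x)‖ := by
    rw [← integral_indicator (measurableSet_farSet N R), ← integral_const_mul,
      ← Real.norm_eq_abs]
    refine norm_integral_le_of_norm_le (hind.const_mul _) (.of_forall fun x => ?_)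
    rw [norm_mul]
    have b1 := abs_cutoff_sub_cutoff_smul_le hL hR h1 h2 x
    have b2 := norm_inner_le_norm (𝕜 := ℝ) (g x) (g (r • x))
    by_cases hx : x ∈ farSet N R
    · rw [Set.indicator_of_mem hx] at b1 ⊢
      exact mul_le_mul b1 b2 (norm_nonneg _) (by positivity)
    · rw [Set.indicator_of_notMem hx] at b1 ⊢
      rw [Real.norm_eq_abs, le_antisymm b1 (abs_nonneg _)]
      simp
  have hcs : ∫ x in farSet N R, ‖g x‖ * ‖g (r • x)‖ ≤
      √(∫ x in farSet N R, ‖g x‖ ^ 2) * √(∫ x, ‖g x‖ ^ 2) := by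
    refine (integral_norm_mul_norm_le (hg.restrict _) (hgr.restrict _)).trans ?_
    gcongr
    exact (setIntegral_le_integral (integrable_norm_sq hgr)
      (.of_forall fun x => sq_nonneg _)).trans (integral_norm_sq_comp_smul_le g h1)
  have hpow : r ^ ((N : ℝ) / 2) ≤ 2 ^ (N + 1) :=
    rpow_le_two_pow h1 h2 (by push_cast; linarith [(Nat.cast_nonneg N : (0 : ℝ) ≤ N)])
  calc _ ≤ 2 ^ (N + 1) * (2 * L * (r - 1) *
        (√(∫ x in farSet N R, ‖g x‖ ^ 2) * √(∫ x, ‖g x‖ ^ 2))) := by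
        gcongr
        exact hb.trans (by gcongr)
    _ = _ := by ring

/-- After the same substitution the powers to compare are r^(N - θ + σ) and r^θ, and N + σ ≤ 2θ = N
- 2 is exactly σ ≤ -2. Radial monotonicity of the cutoff goes in the same direction. -/
theorem integral_cutoff_potential_dilation_nonneg {v : EuclideanSpace ℝ (Fin N) → ℝ}
    (hv : ∀ x, 0 ≤ v x) {R r θ σ : ℝ} (hr : 1 ≤ r) (hθ : θ = N / 2 - 1) (hσ : σ ≤ -2)
    (hint : ∀ s : ℝ, 0 < s → Integrable fun x => cutoff R x * (‖x‖ ^ σ * v x * v (s • x))) :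
    r ^ (-θ) * ∫ x, cutoff R x * (‖x‖ ^ σ * v x * v (r⁻¹ • x)) ≤
      r ^ θ * ∫ x, cutoff R x * (‖x‖ ^ σ * v x * v (r • x)) := by
  have hr0 : 0 < r := by linarith
  have h1 := (hint r⁻¹ (by positivity)).comp_smul hr0.ne'
  simp only [inv_smul_smul₀ hr0.ne'] at h1
  rw [integral_comp_smul_euclidean
    (fun x => cutoff R x * (‖x‖ ^ σ * v x * v (r⁻¹ • x))) hr0, smul_eq_mul, ← mul_assoc,
    ← integral_const_mul, ← integral_const_mul]
  simp only [inv_smul_smul₀ hr0.ne']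
  refine integral_mono (h1.const_mul _) ((hint r hr0).const_mul _) fun x => ?_
  have c : r ^ (-θ) * r ^ N * ‖r • x‖ ^ σ ≤ r ^ θ * ‖x‖ ^ σ := by
    rw [norm_smul, Real.norm_of_nonneg hr0.le, Real.mul_rpow hr0.le (norm_nonneg _), ← mul_assoc,
      ← Real.rpow_natCast, ← Real.rpow_add hr0, ← Real.rpow_add hr0]
    gcongr
    rw [hθ]
    linarith
  have hc := cutoff_smul_le (R := R) hr x
  have h0 := cutoff_nonneg R (r • x)
  have hvx := hv x
  have hvr := hv (r • x)
  calc r ^ (-θ) * r ^ N * (cutoff R (r • x) * (‖r • x‖ ^ σ * v (r • x) * v x)) =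
        (r ^ (-θ) * r ^ N * ‖r • x‖ ^ σ) * (cutoff R (r • x) * (v (r • x) * v x)) := by ring
    _ ≤ (r ^ θ * ‖x‖ ^ σ) * (cutoff R x * (v (r • x) * v x)) := by gcongr
    _ = _ := by ring

end Dilation

/-! ### Terms carrying the gradient of the cutoff, and the Young remainder. -/

section Dilation

variable {N : ℕ}

/-- `A` is a constant for the difference estimate of `exists_integral_sub_dilation_sq_le`. -/
def IsDifferenceConstant (N : ℕ) (A : ℝ) : Prop :=
  0 ≤ A ∧
    ∀ (v : EuclideanSpace ℝ (Fin N) → ℝ) (g : EuclideanSpace ℝ (Fin N) → EuclideanSpace ℝ (Fin N)),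
      MemH1With v g → ∀ R r : ℝ, 0 < R → r ∈ Set.Icc (1 / 2 : ℝ) 2 →
        ∫ x, (cutoff R x * (v (r • x) - v x)) ^ 2 ≤ (A * R * |r - 1| * √(∫ x, ‖g x‖ ^ 2)) ^ 2

theorem norm_gradient_cutoff_le {L R : ℝ} (hL : IsCutoffConstant N L) (hR : 0 < R)
    (x : EuclideanSpace ℝ (Fin N)) :
    ‖gradient (cutoff R) x‖ ≤ (farSet N R).indicator (fun _ => L / R) x := by
  rw [norm_gradient]
  by_cases hx : x ∈ farSet N R
  · rw [Set.indicator_of_mem hx]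
    exact (hL.2 R hR).1 x
  · have hx' : ‖x‖ < R / 2 := not_le.1 hx
    have : cutoff R =ᶠ[nhds x] fun _ => 1 := by
      filter_upwards [Metric.isOpen_ball.mem_nhds
        (mem_ball_zero_iff.2 (by linarith : ‖x‖ < R))] with y hy
      exact cutoff_eq_one hR (mem_ball_zero_iff.1 hy).le
    rw [Set.indicator_of_notMem hx, this.fderiv_eq]
    simp

theorem gradient_cutoff_eq_zero {R : ℝ} (hR : 0 < R) {x : EuclideanSpace ℝ (Fin N)}
    (hx : 2 * R < ‖x‖) : gradient (cutoff R) x = 0 := by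
  have : cutoff R =ᶠ[nhds x] fun _ => 0 := by
    filter_upwards [(isOpen_lt continuous_const continuous_norm).mem_nhds hx] with y hy
    exact cutoff_eq_zero hR (le_of_lt hy)
  simp [gradient, this.fderiv_eq]

theorem integrable_mul_inner_gradient_cutoff {u : EuclideanSpace ℝ (Fin N) → ℝ} (hu : MemLp u 2)
    {g : EuclideanSpace ℝ (Fin N) → EuclideanSpace ℝ (Fin N)} (hg : MemLp g 2) {L R : ℝ}
    (hL : IsCutoffConstant N L) (hR : 0 < R) :
    Integrable fun x => u x * inner ℝ (g x) (gradient (cutoff R) x) := by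
  have h := integrable_inner hg (memLp_smul_bdd (c := gradient (cutoff R)) (C := L / R) hu
    (continuous_gradient (contDiff_cutoff R)).aestronglyMeasurable
    fun x => (norm_gradient _ x).trans_le ((hL.2 R hR).1 x))
  simpa [inner_smul_right] using h

/-- The factor `cutoff (2 * R)` is free, being 1 wherever the gradient of `cutoff R` is nonzero; it
localises `u` so that the difference estimate applies. -/
theorem abs_integral_mul_inner_gradient_cutoff_le {u : EuclideanSpace ℝ (Fin N) → ℝ}
    (hu : MemLp u 2) {g : EuclideanSpace ℝ (Fin N) → EuclideanSpace ℝ (Fin N)} (hg : MemLp g 2)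
    {L R : ℝ} (hL : IsCutoffConstant N L) (hR : 0 < R) :
    |∫ x, u x * inner ℝ (g x) (gradient (cutoff R) x)| ≤
      L / R * (√(∫ x, (cutoff (2 * R) x * u x) ^ 2) * √(∫ x in farSet N R, ‖g x‖ ^ 2)) := by
  have hcu : MemLp (fun x => cutoff (2 * R) x * u x) 2 :=
    memLp_bdd_smul hu (contDiff_cutoff _).continuous.aestronglyMeasurable (abs_cutoff_le_one _)
  have hgi : MemLp ((farSet N R).indicator g) 2 := hg.indicator (measurableSet_farSet N R)
  have hL0 := hL.1
  have hcs := integral_norm_mul_norm_le hcu hgi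
  have e1 : ∫ x, ‖(farSet N R).indicator g x‖ ^ 2 = ∫ x in farSet N R, ‖g x‖ ^ 2 := by
    rw [← integral_indicator (measurableSet_farSet N R)]
    congr 1 with x
    by_cases hx : x ∈ farSet N R <;> simp [hx]
  rw [e1] at hcs
  simp only [Real.norm_eq_abs, sq_abs] at hcs
  rw [← Real.norm_eq_abs]
  refine (norm_integral_le_of_norm_le ((integrable_norm_mul_norm hcu hgi).const_mul (L / R))
    (.of_forall fun x => ?_)).trans ?_
  · have b1 := norm_gradient_cutoff_le hL hR x
    by_cases hx2 : 2 * R < ‖x‖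
    · rw [gradient_cutoff_eq_zero hR hx2]
      simp only [inner_zero_right, mul_zero, norm_zero]
      positivity
    · rw [cutoff_eq_one (by linarith) (not_lt.1 hx2), one_mul, norm_mul]
      have b2 := norm_inner_le_norm (𝕜 := ℝ) (g x) (gradient (cutoff R) x)
      by_cases hx : x ∈ farSet N R
      · rw [Set.indicator_of_mem hx] at b1 ⊢
        calc _ ≤ ‖u x‖ * (‖g x‖ * (L / R)) := by
              gcongr
              exact b2.trans (by gcongr)
          _ = _ := by ring
      · rw [Set.indicator_of_notMem hx] at b1
        rw [norm_le_zero_iff.1 b1]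
        simp [hx]
  · rw [integral_const_mul]
    exact mul_le_mul_of_nonneg_left hcs (by positivity)

/-- The factor `R` in the difference estimate cancels the 1/R of the cutoff gradient. What remains
is |r - 1| times a tail of the Dirichlet energy. -/
theorem abs_integral_dilation_mul_inner_gradient_cutoff_sub_le
    {v : EuclideanSpace ℝ (Fin N) → ℝ} {g : EuclideanSpace ℝ (Fin N) → EuclideanSpace ℝ (Fin N)}
    (h : MemH1With v g) {A L R r : ℝ} (hA : IsDifferenceConstant N A) (hL : IsCutoffConstant N L)
    (hR : 0 < R) (hr : r ∈ Set.Icc (1 / 2 : ℝ) 2) :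
    |(∫ x, v (r • x) * inner ℝ (g x) (gradient (cutoff R) x))
      - ∫ x, v x * inner ℝ (g x) (gradient (cutoff R) x)| ≤
      2 * L * A * √(∫ x, ‖g x‖ ^ 2) * √(∫ x in farSet N R, ‖g x‖ ^ 2) * |r - 1| := by
  have hr0 : r ≠ 0 := by linarith [hr.1]
  have hvr := memLp_comp_smul h.1 hr0
  have hL0 := hL.1
  have hA0 := hA.1
  rw [← integral_sub (integrable_mul_inner_gradient_cutoff hvr h.2.1 hL hR)
    (integrable_mul_inner_gradient_cutoff h.1 h.2.1 hL hR)]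
  simp_rw [← sub_mul]
  refine (abs_integral_mul_inner_gradient_cutoff_le (hvr.sub h.1) h.2.1 hL hR).trans ?_
  have hd := Real.sqrt_le_sqrt (hA.2 v g h (2 * R) r (by linarith) hr)
  rw [Real.sqrt_sq (by positivity)] at hd
  calc _ ≤ L / R * ((A * (2 * R) * |r - 1| * √(∫ x, ‖g x‖ ^ 2)) *
        √(∫ x in farSet N R, ‖g x‖ ^ 2)) := by gcongr; exact hd
    _ = _ := by field_simp

theorem abs_integral_mul_inner_gradient_cutoff_le_div {v : EuclideanSpace ℝ (Fin N) → ℝ}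
    {g : EuclideanSpace ℝ (Fin N) → EuclideanSpace ℝ (Fin N)} (h : MemH1With v g) {L R : ℝ}
    (hL : IsCutoffConstant N L) (hR : 0 < R) :
    |∫ x, v x * inner ℝ (g x) (gradient (cutoff R) x)| ≤
      L * (√(∫ x, v x ^ 2) * √(∫ x, ‖g x‖ ^ 2)) / R := by
  have hL0 := hL.1
  refine (abs_integral_mul_inner_gradient_cutoff_le h.1 h.2.1 hL hR).trans ?_
  have hcv : MemLp (fun x => cutoff (2 * R) x * v x) 2 :=
    memLp_bdd_smul h.1 (contDiff_cutoff _).continuous.aestronglyMeasurable (abs_cutoff_le_one _)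
  have h1 : ∫ x, (cutoff (2 * R) x * v x) ^ 2 ≤ ∫ x, v x ^ 2 := by
    refine integral_mono hcv.integrable_sq
      h.1.integrable_sq fun x => ?_
    simp only [mul_pow]
    have h1 : cutoff (2 * R) x ^ 2 ≤ 1 :=
      (sq_le_one_iff_abs_le_one _).2 (abs_cutoff_le_one _ x)
    nlinarith [sq_nonneg (v x)]
  have h2 : ∫ x in farSet N R, ‖g x‖ ^ 2 ≤ ∫ x, ‖g x‖ ^ 2 :=
    setIntegral_le_integral (integrable_norm_sq h.2.1) (.of_forall fun x => sq_nonneg _)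
  calc _ ≤ L / R * (√(∫ x, v x ^ 2) * √(∫ x, ‖g x‖ ^ 2)) := by gcongr
    _ = _ := by ring

/-- The constant grows with `R`, which is harmless: `R` is fixed while t = r - 1 → 0, and p > 1 in
the application. -/
theorem integral_cutoff_abs_sub_dilation_rpow_le
    {v : EuclideanSpace ℝ (Fin N) → ℝ} {g : EuclideanSpace ℝ (Fin N) → EuclideanSpace ℝ (Fin N)}
    (h : MemH1With v g) {A R r p t : ℝ} (hA : IsDifferenceConstant N A) (hR : 0 < R)
    (hr : r ∈ Set.Icc (1 / 2 : ℝ) 2) (hp0 : 0 ≤ p) (hp2 : p ≤ 2) (ht0 : 0 < t)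
    (ht : |r - 1| ≤ t) :
    ∫ x, cutoff R x * |v x - v (r • x)| ^ p ≤
      t ^ p * (volume.real (Metric.closedBall (0 : EuclideanSpace ℝ (Fin N)) (2 * R)) +
        (A * (2 * R) * √(∫ x, ‖g x‖ ^ 2)) ^ 2) := by
  have hr0 : r ≠ 0 := by linarith [hr.1]
  have hA0 := hA.1
  have hw : MemLp (fun x => cutoff (2 * R) x * (v (r • x) - v x)) 2 :=
    memLp_bdd_smul ((memLp_comp_smul h.1 hr0).sub h.1)
      (contDiff_cutoff _).continuous.aestronglyMeasurable (abs_cutoff_le_one _)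
  have hw2 : Integrable fun x => (cutoff (2 * R) x * (v (r • x) - v x)) ^ 2 :=
    hw.integrable_sq
  have hball : Integrable ((Metric.closedBall (0 : EuclideanSpace ℝ (Fin N)) (2 * R)).indicator
      fun _ => t ^ p) :=
    (integrable_indicator_iff measurableSet_closedBall).2 (integrableOn_const
      (isCompact_closedBall _ _).measure_lt_top.ne)
  calc _ ≤ ∫ x, ((Metric.closedBall (0 : EuclideanSpace ℝ (Fin N)) (2 * R)).indicator
          (fun _ => t ^ p) x + t ^ (p - 2) * (cutoff (2 * R) x * (v (r • x) - v x)) ^ 2) := by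
        refine integral_mono_of_nonneg (.of_forall fun x => ?_) (hball.add (hw2.const_mul _))
          (.of_forall fun x => ?_)
        · exact mul_nonneg (cutoff_nonneg R x) (by positivity)
        · by_cases hx : x ∈ Metric.closedBall (0 : EuclideanSpace ℝ (Fin N)) (2 * R)
          · simp only [Set.indicator_of_mem hx]
            rw [cutoff_eq_one (by linarith) (mem_closedBall_zero_iff.1 hx), one_mul]
            refine (mul_le_of_le_one_left (by positivity) (cutoff_le_one R x)).trans ?_
            rw [abs_sub_comm]
            exact abs_rpow_le_add hp0 hp2 ht0
          · simp only [Set.indicator_of_notMem hx]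
            rw [cutoff_eq_zero hR (not_le.1 (mt mem_closedBall_zero_iff.2 hx)).le]
            simp only [zero_mul, zero_add]
            positivity
    _ = t ^ p * volume.real (Metric.closedBall (0 : EuclideanSpace ℝ (Fin N)) (2 * R)) +
          t ^ (p - 2) * ∫ x, (cutoff (2 * R) x * (v (r • x) - v x)) ^ 2 := by
        rw [integral_add hball (hw2.const_mul _), integral_const_mul,
          integral_indicator measurableSet_closedBall, setIntegral_const, smul_eq_mul, mul_comm]
    _ ≤ t ^ p * volume.real (Metric.closedBall (0 : EuclideanSpace ℝ (Fin N)) (2 * R)) +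
          t ^ (p - 2) * (A * (2 * R) * t * √(∫ x, ‖g x‖ ^ 2)) ^ 2 := by
        gcongr
        exact (hA.2 v g h (2 * R) r (by linarith) hr).trans (by gcongr)
    _ = _ := by
        have : t ^ p = t ^ (p - 2) * t ^ 2 := by
          rw [← Real.rpow_natCast, ← Real.rpow_add ht0]
          congr 1
          push_cast
          ring
        rw [this]
        ring

end Dilation

/-! ### The absorption term. -/

section Dilation

variable {N : ℕ}

theorem integrable_cutoff_mul {f : EuclideanSpace ℝ (Fin N) → ℝ} (hf : Integrable f) (R s : ℝ) :
    Integrable fun x => cutoff R (s • x) * f x :=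
  hf.bdd_mul (c := 1)
    ((contDiff_cutoff R).continuous.comp (continuous_const_smul s)).aestronglyMeasurable
    (.of_forall fun _ => abs_cutoff_le_one R _)

theorem integrable_cutoff_mul' {f : EuclideanSpace ℝ (Fin N) → ℝ} (hf : Integrable f) (R : ℝ) :
    Integrable fun x => cutoff R x * f x := by
  simpa using integrable_cutoff_mul hf R 1

theorem integral_cutoff_smul_ge {f : EuclideanSpace ℝ (Fin N) → ℝ} (hf : Integrable f)
    (hf0 : ∀ x, 0 ≤ f x) {L R r : ℝ} (hL : IsCutoffConstant N L) (hR : 0 < R) (h1 : 1 ≤ r)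
    (h2 : r ≤ 2) :
    (∫ x, cutoff R x * f x) - 2 * L * (r - 1) * ∫ x in farSet N R, f x ≤
      ∫ x, cutoff R (r • x) * f x := by
  have hi := integrable_cutoff_mul hf R r
  have hi1 := integrable_cutoff_mul' hf R
  have hind := hf.indicator (measurableSet_farSet N R)
  rw [sub_le_comm, ← integral_sub hi1 hi, ← integral_indicator (measurableSet_farSet N R),
    ← integral_const_mul]
  refine integral_mono (hi1.sub hi) (hind.const_mul _) fun x => ?_
  have b := (le_abs_self _).trans (abs_cutoff_sub_cutoff_smul_le hL hR h1 h2 x)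
  simp only [← sub_mul]
  by_cases hx : x ∈ farSet N R
  · rw [Set.indicator_of_mem hx] at b ⊢
    exact mul_le_mul_of_nonneg_right b (hf0 x)
  · rw [Set.indicator_of_notMem hx] at b ⊢
    rw [mul_zero]
    exact mul_nonpos_of_nonpos_of_nonneg b (hf0 x)

theorem integral_cutoff_inv_smul_le {f : EuclideanSpace ℝ (Fin N) → ℝ} (hf : Integrable f)
    (hf0 : ∀ x, 0 ≤ f x) {L R r : ℝ} (hL : IsCutoffConstant N L) (hR : 0 < R) (h1 : 1 ≤ r)
    (h2 : r ≤ 2) :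
    ∫ x, cutoff R (r⁻¹ • x) * f x ≤
      (∫ x, cutoff R x * f x) + 2 * L * (r - 1) * ∫ x in farSet N R, f x := by
  have hr0 : 0 < r := by linarith
  have hL0 := hL.1
  have hi := integrable_cutoff_mul hf R r⁻¹
  have hi1 := integrable_cutoff_mul' hf R
  have hind := hf.indicator (measurableSet_farSet N R)
  rw [← sub_le_iff_le_add', ← integral_sub hi hi1, ← integral_indicator (measurableSet_farSet N R),
    ← integral_const_mul]
  refine integral_mono (hi.sub hi1) (hind.const_mul _) fun x => ?_
  have b := (le_abs_self _).trans (abs_cutoff_sub_cutoff_smul_le hL hR h1 h2 (r⁻¹ • x))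
  rw [smul_inv_smul₀ hr0.ne'] at b
  simp only [← sub_mul]
  have hr1 : 0 ≤ r - 1 := by linarith
  by_cases hx : x ∈ farSet N R
  · rw [Set.indicator_of_mem hx]
    refine mul_le_mul_of_nonneg_right (b.trans ?_) (hf0 x)
    by_cases hx' : r⁻¹ • x ∈ farSet N R
    · rw [Set.indicator_of_mem hx']
    · rw [Set.indicator_of_notMem hx']
      positivity
  · have hx' : r⁻¹ • x ∉ farSet N R := by
      intro h
      refine hx (show R / 2 ≤ ‖x‖ from le_trans (show R / 2 ≤ ‖r⁻¹ • x‖ from h) ?_)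
      rw [norm_smul, Real.norm_of_nonneg (by positivity)]
      exact mul_le_of_le_one_left (norm_nonneg _) (inv_le_one_of_one_le₀ h1)
    rw [Set.indicator_of_notMem hx'] at b
    rw [Set.indicator_of_notMem hx, mul_zero]
    exact mul_nonpos_of_nonpos_of_nonneg b (hf0 x)

/-- Upper bound for the antisymmetrised absorption term. -/
theorem integral_cutoff_absorption_dilation_le
    {v : EuclideanSpace ℝ (Fin N) → ℝ} {g : EuclideanSpace ℝ (Fin N) → EuclideanSpace ℝ (Fin N)}
    (h : MemH1With v g) {m : ℝ} (hm : 1 < m) (hv0 : ∀ x, 0 ≤ v x)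
    (hvp : Integrable fun x => v x ^ ((m + 1) / m)) {A L R r θ : ℝ}
    (hA : IsDifferenceConstant N A) (hL : IsCutoffConstant N L) (hR : 0 < R) (h1 : 1 < r)
    (h2 : r ≤ 2) (hθ : θ = N / 2 - 1)
    (hint : ∀ s : ℝ, 0 < s → Integrable fun x => cutoff R x * (v x ^ (1 / m) * v (s • x))) :
    r ^ θ * (∫ x, cutoff R x * (v x ^ (1 / m) * v (r • x)))
      - r ^ (-θ) * (∫ x, cutoff R x * (v x ^ (1 / m) * v (r⁻¹ • x))) ≤
      (m / (m + 1) * (r ^ (θ - N) - r ^ (N - θ)) + (1 - m / (m + 1)) * (r ^ θ - r ^ (-θ))) *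
        (∫ x, cutoff R x * v x ^ ((m + 1) / m)) +
      2 ^ (N + 1) * (4 * L * (r - 1)) * (∫ x in farSet N R, v x ^ ((m + 1) / m)) +
      2 ^ (N + 1) * (r - 1) ^ ((m + 1) / m) *
        (volume.real (Metric.closedBall (0 : EuclideanSpace ℝ (Fin N)) (2 * R)) +
        (A * (2 * R) * √(∫ x, ‖g x‖ ^ 2)) ^ 2) := by
  have hr0 : 0 < r := by linarith
  have hr1 : 0 < r - 1 := by linarith
  have hL0 := hL.1
  have hN : (0 : ℝ) ≤ N := Nat.cast_nonneg N
  set p := (m + 1) / m with hp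
  set q := m / (m + 1) with hq
  have hq0 : 0 ≤ q := by positivity
  have hq1 : q ≤ 1 := by
    rw [hq, div_le_one (by linarith)]
    linarith
  have hp0 : 0 ≤ p := by positivity
  have hp2 : p ≤ 2 := by
    rw [hp, div_le_iff₀ (by linarith)]
    linarith
  have hvp0 : ∀ x, 0 ≤ v x ^ p := fun x => Real.rpow_nonneg (hv0 x) p
  set P := ∫ x, cutoff R x * v x ^ p with hP
  set Q := ∫ x in farSet N R, v x ^ p with hQ
  have hQ0 : 0 ≤ Q := setIntegral_nonneg (measurableSet_farSet N R) fun x _ => hvp0 x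
  set D := volume.real (Metric.closedBall (0 : EuclideanSpace ℝ (Fin N)) (2 * R)) +
        (A * (2 * R) * √(∫ x, ‖g x‖ ^ 2)) ^ 2 with hD
  have hD0 : 0 ≤ D := by positivity
  have hs : ∀ s : ℝ, 0 < s → Integrable fun x => cutoff R x * v (s • x) ^ p := fun s hs =>
    integrable_cutoff_mul' (hvp.comp_smul hs.ne') R
  have hPi := integrable_cutoff_mul' hvp R
  -- the dilation by `r`
  have up1 : ∫ x, cutoff R x * (v x ^ (1 / m) * v (r • x)) ≤
      q * (∫ x, cutoff R x * v (r • x) ^ p) + (1 - q) * P := by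
    rw [hP, ← integral_const_mul, ← integral_const_mul, ← integral_add ((hs r hr0).const_mul _)
      (hPi.const_mul _)]
    refine integral_mono (hint r hr0) (((hs r hr0).const_mul _).add (hPi.const_mul _)) fun x => ?_
    have b := mul_le_mul_of_nonneg_left (rpow_inv_mul_le hm (hv0 x) (hv0 (r • x)))
      (cutoff_nonneg R x)
    simp only
    linarith
  have up2 : ∫ x, cutoff R x * v (r • x) ^ p ≤ (r ^ N)⁻¹ * (P + 2 * L * (r - 1) * Q) := by
    have e := integral_comp_smul_euclidean (fun x => cutoff R (r⁻¹ • x) * v x ^ p) hr0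
    simp only [inv_smul_smul₀ hr0.ne', smul_eq_mul] at e
    have b := integral_cutoff_inv_smul_le hvp hvp0 hL hR h1.le h2
    rw [e] at b
    rwa [le_inv_mul_iff₀ (by positivity)]
  -- the dilation by `r⁻¹`
  have hri : r⁻¹ ∈ Set.Icc (1 / 2 : ℝ) 2 :=
    ⟨by rw [one_div]; exact inv_anti₀ hr0 h2, (inv_le_one_of_one_le₀ h1.le).trans (by norm_num)⟩
  have hri1 : |r⁻¹ - 1| ≤ r - 1 := by
    have : r⁻¹ - 1 = -(r⁻¹ * (r - 1)) := by field_simp; ring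
    rw [this, abs_neg, abs_of_nonneg (by positivity)]
    exact mul_le_of_le_one_left hr1.le (inv_le_one_of_one_le₀ h1.le)
  have lo3 := integral_cutoff_abs_sub_dilation_rpow_le h hA hR hri hp0 hp2 hr1 hri1
  have hw : Integrable fun x => cutoff R x * |v x - v (r⁻¹ • x)| ^ p := by
    refine integrable_cutoff_mul' ((hvp.add (hvp.comp_smul (inv_ne_zero hr0.ne'))).mono' ?_
      (.of_forall fun x => ?_)) R
    · exact ((h.1.1.sub (memLp_comp_smul h.1 (inv_ne_zero hr0.ne')).1).norm.aemeasurable.pow_const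
        p).aestronglyMeasurable
    · rw [Real.norm_of_nonneg (by positivity)]
      have a1 := hv0 x
      have a2 := hv0 (r⁻¹ • x)
      have a3 : |v x - v (r⁻¹ • x)| ≤ max (v x) (v (r⁻¹ • x)) := by
        rw [abs_le]
        constructor <;> linarith [le_max_left (v x) (v (r⁻¹ • x)), le_max_right (v x) (v (r⁻¹ • x))]
      refine (Real.rpow_le_rpow (abs_nonneg _) a3 hp0).trans ?_
      have c1 := hvp0 x
      have c2 := hvp0 (r⁻¹ • x)
      rcases max_cases (v x) (v (r⁻¹ • x)) with ⟨e, -⟩ | ⟨e, -⟩ <;> rw [e] <;>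
        simp only [Pi.add_apply] <;> linarith
  have hsi := hs r⁻¹ (by positivity)
  have lo1 : q * (∫ x, cutoff R x * v (r⁻¹ • x) ^ p) + (1 - q) * P
      - (∫ x, cutoff R x * |v x - v (r⁻¹ • x)| ^ p) ≤
      ∫ x, cutoff R x * (v x ^ (1 / m) * v (r⁻¹ • x)) := by
    have hadd : Integrable fun x => q * (cutoff R x * v (r⁻¹ • x) ^ p) +
        (1 - q) * (cutoff R x * v x ^ p) := (hsi.const_mul _).add (hPi.const_mul _)
    rw [hP, ← integral_const_mul, ← integral_const_mul, ← integral_add (hsi.const_mul _)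
      (hPi.const_mul _), ← integral_sub hadd hw]
    refine integral_mono (hadd.sub hw)
      (hint r⁻¹ (by positivity)) fun x => ?_
    have b := mul_le_mul_of_nonneg_left (le_rpow_inv_mul hm (hv0 x) (hv0 (r⁻¹ • x)))
      (cutoff_nonneg R x)
    simp only
    linarith
  have lo2 : r ^ N * (P - 2 * L * (r - 1) * Q) ≤ ∫ x, cutoff R x * v (r⁻¹ • x) ^ p := by
    have e := integral_comp_smul_euclidean (fun x => cutoff R x * v (r⁻¹ • x) ^ p) hr0
    simp only [inv_smul_smul₀ hr0.ne', smul_eq_mul] at e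
    rw [e]
    exact mul_le_mul_of_nonneg_left (integral_cutoff_smul_ge hvp hvp0 hL hR h1.le h2)
      (by positivity)
  have e1 : r ^ (θ - N) = r ^ θ * (r ^ N)⁻¹ := by
    rw [Real.rpow_sub hr0, Real.rpow_natCast, div_eq_mul_inv]
  have e2 : r ^ (N - θ) = r ^ (-θ) * r ^ N := by
    rw [sub_eq_add_neg, Real.rpow_add hr0, Real.rpow_natCast, mul_comm]
  have hU : r ^ θ * (∫ x, cutoff R x * (v x ^ (1 / m) * v (r • x))) ≤
      q * (r ^ (θ - N) * (P + 2 * L * (r - 1) * Q)) + (1 - q) * r ^ θ * P := by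
    calc _ ≤ r ^ θ * (q * ((r ^ N)⁻¹ * (P + 2 * L * (r - 1) * Q)) + (1 - q) * P) := by
          gcongr
          exact up1.trans (by gcongr)
      _ = _ := by rw [e1]; ring
  have hV : q * (r ^ (N - θ) * (P - 2 * L * (r - 1) * Q)) + (1 - q) * r ^ (-θ) * P
      - r ^ (-θ) * ((r - 1) ^ p * D) ≤
      r ^ (-θ) * ∫ x, cutoff R x * (v x ^ (1 / m) * v (r⁻¹ • x)) := by
    calc _ = r ^ (-θ) * (q * (r ^ N * (P - 2 * L * (r - 1) * Q)) + (1 - q) * P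
          - (r - 1) ^ p * D) := by rw [e2]; ring
      _ ≤ _ := by
          gcongr
          refine le_trans ?_ lo1
          gcongr
  -- θ - N, N - θ = N/2 + 1 and -θ = 1 - N/2 are all at most N + 1.
  have w1 : r ^ (θ - N) ≤ 2 ^ (N + 1) :=
    rpow_le_two_pow h1.le h2 (by push_cast; linarith)
  have w2 : r ^ (N - θ) ≤ 2 ^ (N + 1) :=
    rpow_le_two_pow h1.le h2 (by push_cast; linarith)
  have w3 : r ^ (-θ) ≤ 2 ^ (N + 1) :=
    rpow_le_two_pow h1.le h2 (by push_cast; linarith)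
  have x1 : q * r ^ (θ - N) * (2 * L * (r - 1) * Q) ≤ 2 ^ (N + 1) * (2 * L * (r - 1) * Q) := by
    refine mul_le_mul_of_nonneg_right ?_ (by positivity)
    exact (mul_le_of_le_one_left (by positivity) hq1).trans w1
  have x2 : q * r ^ (N - θ) * (2 * L * (r - 1) * Q) ≤ 2 ^ (N + 1) * (2 * L * (r - 1) * Q) := by
    refine mul_le_mul_of_nonneg_right ?_ (by positivity)
    exact (mul_le_of_le_one_left (by positivity) hq1).trans w2
  have x3 : r ^ (-θ) * ((r - 1) ^ p * D) ≤ 2 ^ (N + 1) * ((r - 1) ^ p * D) := by gcongr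
  linarith

end Dilation

/-! ### Pohozaev inequality and conclusion. -/

section Nonexistence

variable {N : ℕ}

theorem tendsto_setIntegral_farSet {f : EuclideanSpace ℝ (Fin N) → ℝ} (hf : Integrable f) :
    Filter.Tendsto (fun R => ∫ x in farSet N R, f x) Filter.atTop (nhds 0) := by
  have h := tendsto_integral_filter_of_dominated_convergence (μ := volume)
    (l := (Filter.atTop : Filter ℝ)) (F := fun R => (farSet N R).indicator f) (f := fun _ => 0)
    (fun x => ‖f x‖) (.of_forall fun R => hf.1.indicator (measurableSet_farSet N R))
    (.of_forall fun R => .of_forall fun x => norm_indicator_le_norm_self _ _) hf.norm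
    (.of_forall fun x => by
      refine tendsto_const_nhds.congr' ?_
      filter_upwards [Filter.eventually_gt_atTop (2 * ‖x‖)] with R hR
      rw [Set.indicator_of_notMem]
      intro hx
      have : R / 2 ≤ ‖x‖ := hx
      linarith)
  simpa only [integral_indicator (measurableSet_farSet N _), integral_zero] using h

/-- The weak equation tested with the truncated dilation `cutoff R • v (r • ·)`. -/
theorem dilation_identity {v : EuclideanSpace ℝ (Fin N) → ℝ}
    {g : EuclideanSpace ℝ (Fin N) → EuclideanSpace ℝ (Fin N)} (h : MemH1With v g) {m σ : ℝ}
    (hm : 1 < m) (hv0 : ∀ x, 0 ≤ v x) (hvp : Integrable fun x => v x ^ ((m + 1) / m))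
    (heq : ∀ φ Dφ, MemH1With φ Dφ → Integrable (weakIntegrand m σ v φ g Dφ) volume ∧
      ∫ x, weakIntegrand m σ v φ g Dφ x = 0)
    {L R r : ℝ} (hL : IsCutoffConstant N L) (hR : 0 < R) (hr : 0 < r) :
    Integrable (fun x => cutoff R x * (v x ^ (1 / m) * v (r • x))) ∧
    Integrable (fun x => cutoff R x * (‖x‖ ^ σ * v x * v (r • x))) ∧
    r * (∫ x, cutoff R x * inner ℝ (g x) (g (r • x))) +
      (∫ x, v (r • x) * inner ℝ (g x) (gradient (cutoff R) x)) +
      1 / (m - 1) * (∫ x, cutoff R x * (v x ^ (1 / m) * v (r • x))) -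
      (∫ x, cutoff R x * (‖x‖ ^ σ * v x * v (r • x))) = 0 := by
  have hvr := memLp_comp_smul h.1 hr.ne'
  have hgr := memLp_comp_smul h.2.1 hr.ne'
  obtain ⟨hi, h0⟩ := heq _ _ ((h.comp_smul hr).smul_test (contDiff_cutoff R)
    (hasCompactSupport_cutoff hR))
  have i1 : Integrable fun x => cutoff R x * inner ℝ (g x) (g (r • x)) :=
    integrable_cutoff_mul' (integrable_inner h.2.1 hgr) R
  have i2 := integrable_mul_inner_gradient_cutoff hvr h.2.1 hL hR
  have i3 : Integrable fun x => cutoff R x * (v x ^ (1 / m) * v (r • x)) := by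
    refine integrable_cutoff_mul' ((hvp.add (hvp.comp_smul hr.ne')).mono' ?_
      (.of_forall fun x => ?_)) R
    · exact (h.1.1.aemeasurable.pow_const _).aestronglyMeasurable.mul hvr.1
    · have b := rpow_inv_mul_le hm (hv0 x) (hv0 (r • x))
      have c1 : 0 ≤ v x ^ ((m + 1) / m) := Real.rpow_nonneg (hv0 x) _
      have c2 : 0 ≤ v (r • x) ^ ((m + 1) / m) := Real.rpow_nonneg (hv0 _) _
      have q0 : 0 ≤ m / (m + 1) := by positivity
      have q1 : m / (m + 1) ≤ 1 := by
        rw [div_le_one (by linarith)]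
        linarith
      rw [Real.norm_of_nonneg (mul_nonneg (Real.rpow_nonneg (hv0 x) _) (hv0 _)), Pi.add_apply]
      nlinarith
  have e : ∀ x, weakIntegrand m σ v (fun x => cutoff R x * v (r • x)) g
      (fun x => cutoff R x • r • g (r • x) + v (r • x) • gradient (cutoff R) x) x =
      r * (cutoff R x * inner ℝ (g x) (g (r • x))) +
        v (r • x) * inner ℝ (g x) (gradient (cutoff R) x) +
        1 / (m - 1) * (cutoff R x * (v x ^ (1 / m) * v (r • x))) -
        cutoff R x * (‖x‖ ^ σ * v x * v (r • x)) := by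
    intro x
    simp only [weakIntegrand, inner_add_right, inner_smul_right]
    ring
  have i123 : Integrable fun x => r * (cutoff R x * inner ℝ (g x) (g (r • x))) +
        v (r • x) * inner ℝ (g x) (gradient (cutoff R) x) +
        1 / (m - 1) * (cutoff R x * (v x ^ (1 / m) * v (r • x))) :=
    ((i1.const_mul r).add i2).add (i3.const_mul _)
  -- The singular term is integrable as the difference of the other three terms and the full
  -- integrand, whose integrability is part of the notion of solution.
  have i4 : Integrable fun x => cutoff R x * (‖x‖ ^ σ * v x * v (r • x)) := by
    refine (i123.sub hi).congr (.of_forall fun x => ?_)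
    simp only [Pi.sub_apply]
    rw [e]
    ring
  refine ⟨i3, i4, ?_⟩
  have i12 : Integrable fun x => r * (cutoff R x * inner ℝ (g x) (g (r • x))) +
        v (r • x) * inner ℝ (g x) (gradient (cutoff R) x) := (i1.const_mul r).add i2
  simp_rw [e] at h0
  rw [integral_sub i123 i4, integral_add i12 (i3.const_mul _), integral_add (i1.const_mul r) i2,
    integral_const_mul, integral_const_mul] at h0
  exact h0

/-- The truncated Pohozaev inequality. -/
theorem truncated_pohozaev {v : EuclideanSpace ℝ (Fin N) → ℝ}
    {g : EuclideanSpace ℝ (Fin N) → EuclideanSpace ℝ (Fin N)} (h : MemH1With v g) {m σ : ℝ}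
    (hm : 1 < m) (hσ : σ ≤ -2) (hv0 : ∀ x, 0 ≤ v x)
    (hvp : Integrable fun x => v x ^ ((m + 1) / m))
    (heq : ∀ φ Dφ, MemH1With φ Dφ → Integrable (weakIntegrand m σ v φ g Dφ) volume ∧
      ∫ x, weakIntegrand m σ v φ g Dφ x = 0)
    {A L R : ℝ} (hA : IsDifferenceConstant N A) (hL : IsCutoffConstant N L) (hR : 0 < R) :
    2 * (1 / (m - 1)) * (∫ x, cutoff R x * v x ^ ((m + 1) / m)) ≤
      2 ^ (N + 1) * (2 * L) * (√(∫ x in farSet N R, ‖g x‖ ^ 2) * √(∫ x, ‖g x‖ ^ 2)) +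
      2 * 2 ^ (N + 1) *
        (2 * L * A * √(∫ x, ‖g x‖ ^ 2) * √(∫ x in farSet N R, ‖g x‖ ^ 2)) +
      |(N : ℝ) - 2| * (L * (√(∫ x, v x ^ 2) * √(∫ x, ‖g x‖ ^ 2)) / R) +
      1 / (m - 1) * (2 ^ (N + 1) * (4 * L) * (∫ x in farSet N R, v x ^ ((m + 1) / m))) := by
  have hid := fun r hr => dilation_identity h hm hv0 hvp heq hL hR (r := r) hr
  set Γ := √(∫ x, ‖g x‖ ^ 2)
  set γ := √(∫ x in farSet N R, ‖g x‖ ^ 2)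
  set P := ∫ x, cutoff R x * v x ^ ((m + 1) / m) with hP
  set Q := ∫ x in farSet N R, v x ^ ((m + 1) / m) with hQ
  set T₁ := L * (√(∫ x, v x ^ 2) * Γ) / R with hT₁
  set κ := 1 / (m - 1) with hκ
  have hκ0 : 0 < κ := one_div_pos.2 (by linarith)
  set D := volume.real (Metric.closedBall (0 : EuclideanSpace ℝ (Fin N)) (2 * R)) +
        (A * (2 * R) * Γ) ^ 2 with hD
  set p := (m + 1) / m with hp
  set q := m / (m + 1) with hq
  obtain ⟨θ, hθ⟩ : ∃ θ : ℝ, θ = N / 2 - 1 := ⟨_, rfl⟩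
  have hL0 := hL.1
  have hA0 := hA.1
  have hN : (0 : ℝ) ≤ N := Nat.cast_nonneg N
  have hP0 : 0 ≤ P := integral_nonneg fun x =>
    mul_nonneg (cutoff_nonneg R x) (Real.rpow_nonneg (hv0 x) _)
  -- `-k r` is the coefficient of `P` in the absorption bound; `d r` weighs the boundary term `t₀`.
  set k : ℝ → ℝ := fun r => q * (r ^ (N - θ) - r ^ (θ - N)) - (1 - q) * (r ^ θ - r ^ (-θ)) with hk
  set d : ℝ → ℝ := fun r => r ^ θ - r ^ (-θ) with hd
  set E := 2 ^ (N + 1) * (2 * L) * (γ * Γ) + 2 * 2 ^ (N + 1) * (2 * L * A * Γ * γ) +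
    κ * (2 ^ (N + 1) * (4 * L) * Q) with hE
  have main : ∀ r, 1 < r → r ≤ 2 → κ * k r * P ≤
      (r - 1) * E + |d r| * T₁ + κ * 2 ^ (N + 1) * ((r - 1) ^ p * D) := by
    intro r h1 h2
    have hr0 : 0 < r := by linarith
    obtain ⟨-, -, id1⟩ := hid r hr0
    obtain ⟨-, -, id2⟩ := hid r⁻¹ (by positivity)
    have ha := abs_integral_cutoff_inner_dilation_le h.2.1 hL hR h1.le h2 hθ
    have hc := integral_cutoff_potential_dilation_nonneg hv0 h1.le hθ hσ
      fun s hs => (hid s hs).2.1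
    have hb := integral_cutoff_absorption_dilation_le h hm hv0 hvp hA hL hR h1 h2 hθ
      fun s hs => (hid s hs).1
    have hri : r⁻¹ ∈ Set.Icc (1 / 2 : ℝ) 2 :=
      ⟨by rw [one_div]; exact inv_anti₀ hr0 h2, (inv_le_one_of_one_le₀ h1.le).trans (by norm_num)⟩
    have ht1 := abs_integral_dilation_mul_inner_gradient_cutoff_sub_le h hA hL hR
      (⟨by linarith, h2⟩ : r ∈ Set.Icc (1 / 2 : ℝ) 2)
    have ht2 := abs_integral_dilation_mul_inner_gradient_cutoff_sub_le h hA hL hR hri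
    have ht3 := abs_integral_mul_inner_gradient_cutoff_le_div h hL hR
    have hr1 : 0 < r - 1 := by linarith
    have hri1 : |r⁻¹ - 1| ≤ r - 1 := by
      have : r⁻¹ - 1 = -(r⁻¹ * (r - 1)) := by field_simp; ring
      rw [this, abs_neg, abs_of_nonneg (by positivity)]
      exact mul_le_of_le_one_left hr1.le (inv_le_one_of_one_le₀ h1.le)
    rw [abs_of_pos hr1] at ht1
    set a₁ := ∫ x, cutoff R x * inner ℝ (g x) (g (r • x))
    set a₂ := ∫ x, cutoff R x * inner ℝ (g x) (g (r⁻¹ • x))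
    set t₁ := ∫ x, v (r • x) * inner ℝ (g x) (gradient (cutoff R) x)
    set t₂ := ∫ x, v (r⁻¹ • x) * inner ℝ (g x) (gradient (cutoff R) x)
    set t₀ := ∫ x, v x * inner ℝ (g x) (gradient (cutoff R) x)
    set b₁ := ∫ x, cutoff R x * (v x ^ (1 / m) * v (r • x))
    set b₂ := ∫ x, cutoff R x * (v x ^ (1 / m) * v (r⁻¹ • x))
    set c₁ := ∫ x, cutoff R x * (‖x‖ ^ σ * v x * v (r • x))
    set c₂ := ∫ x, cutoff R x * (‖x‖ ^ σ * v x * v (r⁻¹ • x))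
    have w1 : r ^ θ ≤ 2 ^ (N + 1) := rpow_le_two_pow h1.le h2 (by push_cast; linarith)
    have w2 : r ^ (-θ) ≤ 2 ^ (N + 1) := rpow_le_two_pow h1.le h2 (by push_cast; linarith)
    set S := 2 * L * A * Γ * γ with hS
    have hS0 : 0 ≤ S := by positivity
    have j1 : r ^ θ * (t₁ - t₀) ≤ 2 ^ (N + 1) * (S * (r - 1)) := by
      calc _ ≤ r ^ θ * (S * (r - 1)) := by
            gcongr
            exact (abs_le.1 ht1).2
        _ ≤ _ := by gcongr
    have j2 : r ^ (-θ) * (t₀ - t₂) ≤ 2 ^ (N + 1) * (S * (r - 1)) := by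
      have : S * |r⁻¹ - 1| ≤ S * (r - 1) := by gcongr
      calc _ ≤ r ^ (-θ) * (S * (r - 1)) := by
            gcongr
            linarith [(abs_le.1 ht2).1]
        _ ≤ _ := by gcongr
    have j3 : d r * t₀ ≤ |d r| * T₁ := by
      refine (le_abs_self _).trans ?_
      rw [abs_mul]
      gcongr
    have j4 : r ^ θ * (r * a₁) - r ^ (-θ) * (r⁻¹ * a₂) ≤
        2 ^ (N + 1) * (2 * L * (r - 1)) * (γ * Γ) := (abs_le.1 ha).2
    -- Inserting `t₀` splits the boundary terms into differences, small by the tail energy times r -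
    -- 1, and `d r * t₀`, where `t₀` is bounded by a multiple of 1/R.
    have hcomb : (r ^ θ * (r * a₁) - r ^ (-θ) * (r⁻¹ * a₂)) +
        (r ^ θ * (t₁ - t₀) + r ^ (-θ) * (t₀ - t₂) + d r * t₀) +
        κ * (r ^ θ * b₁ - r ^ (-θ) * b₂) - (r ^ θ * c₁ - r ^ (-θ) * c₂) = 0 := by
      linear_combination r ^ θ * id1 - r ^ (-θ) * id2
    have hb' := mul_le_mul_of_nonneg_left hb hκ0.le
    have hkk : κ * ((q * (r ^ (θ - N) - r ^ (N - θ)) + (1 - q) * (r ^ θ - r ^ (-θ))) * P +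
        2 ^ (N + 1) * (4 * L * (r - 1)) * Q + 2 ^ (N + 1) * (r - 1) ^ p * D) =
        - (κ * k r * P) + κ * (2 ^ (N + 1) * (4 * L) * Q) * (r - 1) +
          κ * 2 ^ (N + 1) * ((r - 1) ^ p * D) := by
      simp only [hk]
      ring
    rw [hkk] at hb'
    have hEE : (r - 1) * E = 2 ^ (N + 1) * (2 * L * (r - 1)) * (γ * Γ) +
      2 * (2 ^ (N + 1) * (S * (r - 1))) + κ * (2 ^ (N + 1) * (4 * L) * Q) * (r - 1) := by
      rw [hE]
      ring
    linarith
  have hdpow : ∀ e : ℝ, HasDerivAt (fun r : ℝ => r ^ e) e 1 := fun e => by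
    simpa using Real.hasDerivAt_rpow_const (x := 1) (p := e) (Or.inl one_ne_zero)
  have hdd : HasDerivAt d ((N : ℝ) - 2) 1 :=
    ((hdpow θ).sub (hdpow (-θ))).congr_deriv (by rw [hθ]; ring)
  have hdk : HasDerivAt k (2 * q * N - N + 2) 1 :=
    ((((hdpow (N - θ)).sub (hdpow (θ - N))).const_mul q).sub
      (((hdpow θ).sub (hdpow (-θ))).const_mul (1 - q))).congr_deriv (by rw [hθ]; ring)
  have slope_lim : ∀ {f : ℝ → ℝ} {f' : ℝ}, f 1 = 0 → HasDerivAt f f' 1 →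
      Filter.Tendsto (fun r => (r - 1)⁻¹ * f r) (nhdsWithin 1 (Set.Ioi 1)) (nhds f') := by
    intro f f' hf0 hf
    have := (hasDerivAt_iff_tendsto_slope.1 hf).mono_left
      (nhdsWithin_mono 1 (fun x (hx : 1 < x) => hx.ne') : nhdsWithin 1 (Set.Ioi (1 : ℝ)) ≤ _)
    refine this.congr fun r => ?_
    simp [slope, hf0]
  have lk := slope_lim (by simp [hk]) hdk
  have ld := (slope_lim (by simp [hd]) hdd).abs
  have lp : Filter.Tendsto (fun r : ℝ => (r - 1) ^ (p - 1)) (nhdsWithin 1 (Set.Ioi 1))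
      (nhds 0) := by
    have hp1 : 0 < p - 1 := by
      have : p - 1 = 1 / m := by rw [hp]; field_simp; ring
      rw [this]
      positivity
    have c : Continuous fun r : ℝ => (r - 1) ^ (p - 1) :=
      (continuous_id.sub continuous_const).rpow_const fun _ => Or.inr hp1.le
    have := c.tendsto 1
    simp only [sub_self, Real.zero_rpow hp1.ne'] at this
    exact this.mono_left nhdsWithin_le_nhds
  -- Division by r - 1 and r → 1+ at fixed `R`: the Young remainder disappears because p - 1 = 1/m >
  -- 0.
  have lim := le_of_tendsto_of_tendsto ((lk.const_mul κ).mul_const P)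
    (((ld.mul_const T₁).const_add E).add ((lp.mul_const D).const_mul (κ * 2 ^ (N + 1)))) (by
      filter_upwards [Ioc_mem_nhdsGT (by norm_num : (1 : ℝ) < 2)] with r hr
      have hr1 : 0 < r - 1 := by linarith [hr.1]
      have := mul_le_mul_of_nonneg_left (main r hr.1 hr.2) (inv_pos.2 hr1).le
      have e1 : (r - 1) ^ p = (r - 1) ^ (p - 1) * (r - 1) := by
        rw [← Real.rpow_add_one hr1.ne', sub_add_cancel]
      have e2 : |(r - 1)⁻¹ * d r| = (r - 1)⁻¹ * |d r| := by
        rw [abs_mul, abs_of_pos (inv_pos.2 hr1)]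
      rw [e1] at this
      simp only [e2]
      calc _ = (r - 1)⁻¹ * (κ * k r * P) := by ring
        _ ≤ _ := this
        _ = _ := by field_simp)
  -- m > 1 gives k'(1) = (2q - 1)N + 2 ≥ 2.
  have hq2 : 1 ≤ 2 * q := by
    rw [hq, ← mul_div_assoc, le_div_iff₀ (by linarith)]
    linarith
  have : 2 * κ * P ≤ κ * (2 * q * N - N + 2) * P := by
    rw [mul_comm 2 κ]
    gcongr
    nlinarith
  rw [hE] at lim
  linarith

theorem ae_eq_zero_of_weak_solution {v : EuclideanSpace ℝ (Fin N) → ℝ}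
    {g : EuclideanSpace ℝ (Fin N) → EuclideanSpace ℝ (Fin N)} (h : MemH1With v g) {m σ : ℝ}
    (hm : 1 < m) (hσ : σ ≤ -2) (hv0 : ∀ x, 0 ≤ v x)
    (hvp : Integrable fun x => v x ^ ((m + 1) / m))
    (heq : ∀ φ Dφ, MemH1With φ Dφ → Integrable (weakIntegrand m σ v φ g Dφ) volume ∧
      ∫ x, weakIntegrand m σ v φ g Dφ x = 0) :
    ∀ᵐ x, v x = 0 := by
  obtain ⟨A, hA⟩ := exists_integral_sub_dilation_sq_le N
  obtain ⟨L, hL⟩ := exists_cutoff_lipschitz N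
  have hκ0 : 0 < 1 / (m - 1) := one_div_pos.2 (by linarith)
  have hvp0 : ∀ x, 0 ≤ v x ^ ((m + 1) / m) := fun x => Real.rpow_nonneg (hv0 x) _
  have lg := (tendsto_setIntegral_farSet (integrable_norm_sq h.2.1)).sqrt
  have lv := tendsto_setIntegral_farSet hvp
  rw [Real.sqrt_zero] at lg
  have lR : Filter.Tendsto (fun R : ℝ => L * (√(∫ x, v x ^ 2) * √(∫ x, ‖g x‖ ^ 2)) / R)
      Filter.atTop (nhds 0) := Filter.Tendsto.const_div_atTop Filter.tendsto_id _
  have lim := (((((lg.mul_const √(∫ x, ‖g x‖ ^ 2)).const_mul (2 ^ (N + 1) * (2 * L))).add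
    ((lg.const_mul (2 * L * A * √(∫ x, ‖g x‖ ^ 2))).const_mul (2 * 2 ^ (N + 1)))).add
    (lR.const_mul |(N : ℝ) - 2|)).add
    ((lv.const_mul (2 ^ (N + 1) * (4 * L))).const_mul (1 / (m - 1)))).add
    (lv.const_mul (2 * (1 / (m - 1))))
  simp only [mul_zero, zero_mul, add_zero] at lim
  have hle : 2 * (1 / (m - 1)) * ∫ x, v x ^ ((m + 1) / m) ≤ 0 := by
    refine ge_of_tendsto lim ?_
    filter_upwards [Filter.eventually_gt_atTop 0] with R hR
    have hpoh := truncated_pohozaev h hm hσ hv0 hvp heq hA hL hR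
    -- The mass lost to the cutoff lies in the far region; the last summand of `lim` accounts for
    -- it.
    have hsplit : ∫ x, v x ^ ((m + 1) / m) ≤ (∫ x, cutoff R x * v x ^ ((m + 1) / m)) +
        ∫ x in farSet N R, v x ^ ((m + 1) / m) := by
      rw [← integral_indicator (measurableSet_farSet N R), ← integral_add
        (integrable_cutoff_mul' hvp R) (hvp.indicator (measurableSet_farSet N R))]
      refine integral_mono hvp ((integrable_cutoff_mul' hvp R).add
        (hvp.indicator (measurableSet_farSet N R))) fun x => ?_
      by_cases hx : x ∈ farSet N R
      · simp only [Set.indicator_of_mem hx]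
        have := mul_nonneg (cutoff_nonneg R x) (hvp0 x)
        linarith
      · have hx' : ‖x‖ < R / 2 := not_le.1 hx
        simp only [Set.indicator_of_notMem hx]
        rw [cutoff_eq_one hR (by linarith)]
        simp
    have := mul_le_mul_of_nonneg_left hsplit (by positivity : 0 ≤ 2 * (1 / (m - 1)))
    linarith
  have hzero : ∫ x, v x ^ ((m + 1) / m) = 0 := by
    refine le_antisymm ?_ (integral_nonneg hvp0)
    by_contra! hc
    exact absurd hle (not_le.2 (by positivity))
  filter_upwards [(integral_eq_zero_iff_of_nonneg hvp0 hvp).1 hzero] with x hx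
  exact ((Real.rpow_eq_zero_iff_of_nonneg (hv0 x)).1 hx).1

end Nonexistence

theorem MemH1With.congr_ae {N : ℕ} {u w : EuclideanSpace ℝ (Fin N) → ℝ}
    {G : EuclideanSpace ℝ (Fin N) → EuclideanSpace ℝ (Fin N)} (h : MemH1With u G)
    (huw : u =ᵐ[volume] w) : MemH1With w G := by
  obtain ⟨hu, hG, -, hGl, hw⟩ := h
  have hw2 := hu.ae_eq huw
  refine ⟨hw2, hG, hw2.locallyIntegrable (by simp), hGl, fun η hη hc i => ?_⟩
  rw [← hw η hη hc i]
  refine integral_congr_ae ?_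
  filter_upwards [huw] with x hx
  rw [hx]

theorem theorem3 (N : ℕ) (hN : 1 ≤ N) (m σ : ℝ) (hm : 1 < m) (hσ : σ ≤ -2) :
    ¬ ∃ v : EuclideanSpace ℝ (Fin N) → ℝ,
      IsNonnegVariationalSolution m σ v ∧ ¬ (∀ᵐ x, v x = 0) := by
  rintro ⟨v, ⟨⟨-, hvp⟩, hv0, g, hg, heq⟩, hne⟩
  apply hne
  -- Passing to the representative max(v, 0) makes nonnegativity hold at every point, hence also at
  -- all dilated points.
  have hvw : v =ᵐ[volume] fun x => max (v x) 0 := by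
    filter_upwards [hv0] with x hx
    rw [max_eq_left hx]
  have hp : 0 < (m + 1) / m := by positivity
  have hint : Integrable fun x => max (v x) 0 ^ ((m + 1) / m) := by
    have h1 := (hvp.ae_eq hvw).integrable_norm_rpow (by simpa using hp) (by simp)
    rw [ENNReal.toReal_ofReal hp.le] at h1
    refine h1.congr (.of_forall fun x => ?_)
    simp only
    rw [Real.norm_of_nonneg (le_max_right _ _)]
  have key := ae_eq_zero_of_weak_solution (hg.congr_ae hvw) hm hσ (fun x => le_max_right _ _) hint
    (fun φ Dφ hφ => by
      obtain ⟨h1, h2⟩ := heq φ Dφ hφ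
      have e : weakIntegrand m σ v φ g Dφ =ᵐ[volume]
          weakIntegrand m σ (fun x => max (v x) 0) φ g Dφ := by
        filter_upwards [hvw] with x hx
        simp only [weakIntegrand]
        rw [← hx]
      exact ⟨h1.congr e, by rw [← integral_congr_ae e, h2]⟩)
  filter_upwards [key, hvw] with x h1 h2
  rw [h2, h1]
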